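/- Let $d\ge 1$ be an integer and $s>0$, and set $p_*=p_*(s,d)=\frac{2d}{d-2s}$ if $s<d/2$ and $p_*=\infty$ if $s\ge d/2$. Let $\mathcal F$ be the Fourier transform on $L^2(\mathbb R^d)$ (all functions are complex-valued), with $(\mathcal Ff)(\xi)=\int_{\mathbb R^d}e^{-2\pi i x\cdot\xi}f(x)\,dx$ for Schwartz functions. Let $H^s(\mathbb R^d)$ be the $L^2$-Sobolev space with norm $\|f\|_{H^s}^2=\int_{\mathbb R^d}(1+|2\pi\xi|^2)^s|\mathcal Ff(\xi)|^2\,d\xi$. For a measurable $A\subset\mathbb R^d$ of finite measure let $A^*$ be the open ball centred at $0$ with $|A^*|=|A|$ ($A^*=\emptyset$ if $|A|=0$); for a measurable $g:\mathbb R^d\to\mathbb C$ with $|\{|g|>t\}|<\infty$ for all $t>0$ let $g^*(x)=\int_0^\infty \mathbf 1_{\{|g|>t\}^*}(x)\,dt$ be its symmetric-decreasing rearrangement. For $f\in L^2(\mathbb R^d)$ let $f^\sharp=\mathcal F^{-1}\{(\mathcal Ff)^*\}\in L^2(\mathbb R^d)$ be its Fourier rearrangement, and let $H^{s,\sharp}(\mathbb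 R^d)=\{f\in H^s(\mathbb R^d): f=f^\sharp\}$. **Lemma.** The set $H^{s,\sharp}(\mathbb R^d)$ is compactly embedded in $L^p(\mathbb R^d)$ for every $2<p<p_*$; that is, $H^{s,\sharp}(\mathbb R^d)\subset L^p(\mathbb R^d)$, there is a constant $C$ with $\|f-g\|_{L^p}\le C\|f-g\|_{H^s}$ for all $f,g\in H^{s,\sharp}(\mathbb R^d)$, and every sequence in $H^{s,\sharp}(\mathbb R^d)$ that is bounded in $H^s(\mathbb R^d)$ has a subsequence that converges strongly in $L^p(\mathbb R^d)$. More precisely, if $(f_k)$ is a bounded sequence in $H^s(\mathbb R^d)$ with $f_k=f_k^\sharp$ for all $k$, then there exist a subsequence $(f_{k_m})$ and some $f\in H^{s,\sharp}(\mathbb R^d)$, both independent of $p$, such that, for every $2<p<p_*$, $f\in L^p(\mathbb R^d)$ and $f_{k_m}\to f$ strongly in $L^p(\mathbb R^d)$ as $m\to\infty$. -/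

import Mathlib

open MeasureTheory Set Filter Topology
open scoped ENNReal NNReal FourierTransform SchwartzMap

noncomputable section

namespace FourierRearr

/-- Euclidean space `ℝ^d`. -/
abbrev Space (d : ℕ) : Type := EuclideanSpace ℝ (Fin d)

/-- The Hilbert space `L²(ℝ^d)` of (classes of) complex-valued functions. -/
abbrev L2 (d : ℕ) : Type := Lp ℂ 2 (volume : Measure (Space d))

/-! ### Symmetric-decreasing rearrangement -/

/-- The radius `R ≥ 0` with `|B_R(0)| = |A|`, for a set `A ⊆ ℝ^d` of finite measure. -/
def ballRadius {d : ℕ} (A : Set (Space d)) : ℝ :=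
  (volume A / volume (Metric.ball (0 : Space d) 1)).toReal ^ ((d : ℝ)⁻¹)

/-- `A^*`: the open ball centred at the origin with the same measure as `A`
(the empty set if `A` is a null set). -/
def setRearr {d : ℕ} (A : Set (Space d)) : Set (Space d) :=
  Metric.ball 0 (ballRadius A)

/-- The defining property of `A^*`. -/
theorem volume_setRearr {d : ℕ} [NeZero d] (A : Set (Space d)) (hA : volume A ≠ ∞) :
    volume (setRearr A) = volume A := by
  have hd : (d : ℝ) ≠ 0 := Nat.cast_ne_zero.mpr (NeZero.ne d)
  have hb0 : volume (Metric.ball (0 : Space d) 1) ≠ 0 :=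
    (Metric.measure_ball_pos volume 0 one_pos).ne'
  have hbt : volume (Metric.ball (0 : Space d) 1) ≠ ∞ := measure_ball_lt_top.ne
  have hne : Nonempty (Fin d) := ⟨⟨0, Nat.pos_of_ne_zero (NeZero.ne d)⟩⟩
  have hR : 0 ≤ ballRadius A := Real.rpow_nonneg ENNReal.toReal_nonneg _
  rw [setRearr, Measure.addHaar_ball volume 0 hR]
  have h1 : ballRadius A ^ Module.finrank ℝ (Space d)
      = (volume A / volume (Metric.ball (0 : Space d) 1)).toReal := by
    rw [finrank_euclideanSpace_fin, ballRadius, ← Real.rpow_natCast,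
      ← Real.rpow_mul ENNReal.toReal_nonneg, inv_mul_cancel₀ hd, Real.rpow_one]
  rw [h1, ENNReal.ofReal_toReal (ENNReal.div_ne_top hA hb0), ENNReal.div_mul_cancel hb0 hbt]

/-- The symmetric-decreasing rearrangement `g^*(x) = ∫₀^∞ 1_{{|g| > t}^*}(x) dt`. It takes values in
`[0, ∞]`; for `g` vanishing at infinity the value `∞` can occur only at the origin. -/
def symmRearr {d : ℕ} (g : Space d → ℂ) (x : Space d) : ℝ≥0∞ :=
  ∫⁻ t in Ioi (0 : ℝ), (setRearr {y | t < ‖g y‖}).indicator 1 x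

theorem measurable_symmRearr {d : ℕ} (g : Space d → ℂ) : Measurable (symmRearr g) := by
  have hm : Measurable fun t : ℝ => volume {y | t < ‖g y‖} :=
    Antitone.measurable fun a b hab => measure_mono fun y (hy : b < ‖g y‖) => hab.trans_lt hy
  have hR : Measurable fun t : ℝ => ballRadius {y | t < ‖g y‖} := by
    unfold ballRadius
    exact ((hm.div_const _).ennreal_toReal).pow_const _
  have hS : MeasurableSet {q : Space d × ℝ | ‖q.1‖ < ballRadius {y | q.2 < ‖g y‖}} :=
    measurableSet_lt measurable_fst.norm (hR.comp measurable_snd)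
  have hF : Measurable fun q : Space d × ℝ =>
      (setRearr {y | q.2 < ‖g y‖}).indicator (1 : Space d → ℝ≥0∞) q.1 := by
    have h2 : (fun q : Space d × ℝ =>
        (setRearr {y | q.2 < ‖g y‖}).indicator (1 : Space d → ℝ≥0∞) q.1)
        = {q : Space d × ℝ | ‖q.1‖ < ballRadius {y | q.2 < ‖g y‖}}.indicator 1 := by
      funext q
      simp only [Set.indicator, setRearr, mem_ball_zero_iff, mem_ofPred_eq, Pi.one_apply]
    rw [h2]
    exact measurable_one.indicator hS
  exact hF.lintegral_prod_right'

/-- Rearrangement preserves square-integrability. -/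
theorem memLp_symmRearr {d : ℕ} [NeZero d] (g : Space d → ℂ) (hg : MemLp g 2 volume) :
    MemLp (fun x => ((symmRearr g x).toReal : ℂ)) 2 volume := by
  have hmeas := measurable_symmRearr g
  have hfin : ∀ t : ℝ, 0 < t → volume {y | t < ‖g y‖} ≠ ∞ := fun t ht => by
    have := hg.meas_ge_lt_top (by norm_num) (by norm_num) (ε := ⟨t, ht.le⟩)
      (fun h => ht.ne' (congrArg NNReal.toReal h))
    refine (lt_of_le_of_lt (measure_mono fun y hy => ?_) this).ne
    exact_mod_cast (le_of_lt hy : t ≤ ‖g y‖)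
  have hsub : ∀ τ : ℝ, 0 < τ →
      {x | τ < (symmRearr g x).toReal} ⊆ setRearr {y | τ < ‖g y‖} := by
    intro τ hτ x hx
    by_contra hnot
    have hle : symmRearr g x ≤ ENNReal.ofReal τ := by
      calc symmRearr g x
          ≤ ∫⁻ t in Ioi (0 : ℝ), (Ioc (0 : ℝ) τ).indicator 1 t := by
            refine setLIntegral_mono (measurable_one.indicator measurableSet_Ioc) fun t ht => ?_
            by_cases hxt : x ∈ setRearr {y | t < ‖g y‖}
            · have htτ : t ≤ τ := by
                by_contra! hlt
                refine hnot (Metric.ball_subset_ball ?_ hxt)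
                refine Real.rpow_le_rpow ENNReal.toReal_nonneg ?_ (by positivity)
                refine ENNReal.toReal_mono (ENNReal.div_ne_top (hfin τ hτ)
                  (Metric.measure_ball_pos volume 0 one_pos).ne') ?_
                exact ENNReal.div_le_div_right
                  (measure_mono fun y (hy : t < ‖g y‖) => hlt.trans hy) _
              have : t ∈ Ioc (0 : ℝ) τ := ⟨ht, htτ⟩
              simp [hxt, this]
            · simp [hxt]
        _ ≤ ∫⁻ t, (Ioc (0 : ℝ) τ).indicator 1 t := setLIntegral_le_lintegral _ _
        _ = ENNReal.ofReal τ := by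
            rw [lintegral_indicator_one measurableSet_Ioc, Real.volume_Ioc, sub_zero]
    have := ENNReal.toReal_mono ENNReal.ofReal_ne_top hle
    rw [ENNReal.toReal_ofReal hτ.le] at this
    exact absurd hx (not_lt.mpr this)
  have hle : ∀ τ : ℝ, 0 < τ →
      volume {x | τ < (symmRearr g x).toReal} ≤ volume {y | τ < ‖g y‖} := fun τ hτ =>
    (measure_mono (hsub τ hτ)).trans (volume_setRearr _ (hfin τ hτ)).le
  have hint : ∫⁻ x, ENNReal.ofReal ((symmRearr g x).toReal ^ (2 : ℝ))
      ≤ ∫⁻ x, ENNReal.ofReal (‖g x‖ ^ (2 : ℝ)) := by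
    rw [lintegral_rpow_eq_lintegral_meas_lt_mul volume
        (Eventually.of_forall fun _ => ENNReal.toReal_nonneg)
        hmeas.ennreal_toReal.aemeasurable two_pos,
      lintegral_rpow_eq_lintegral_meas_lt_mul volume
        (Eventually.of_forall fun _ => norm_nonneg _)
        hg.1.norm.aemeasurable two_pos]
    gcongr ENNReal.ofReal 2 * ?_
    refine setLIntegral_mono' measurableSet_Ioi fun t ht => ?_
    exact mul_le_mul_left (hle t ht) _
  have hcv : ∀ a : ℝ, 0 ≤ a → ENNReal.ofReal (a ^ (2 : ℝ)) = ENNReal.ofReal a ^ (2 : ℝ) :=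
    fun a ha => (ENNReal.ofReal_rpow_of_nonneg ha two_pos.le).symm
  refine ⟨(Complex.measurable_ofReal.comp hmeas.ennreal_toReal).aestronglyMeasurable, ?_⟩
  have hg2 := hg.2
  rw [eLpNorm_lt_top_iff_lintegral_rpow_enorm_lt_top (by norm_num) (by norm_num)] at hg2 ⊢
  refine lt_of_le_of_lt ?_ hg2
  simp only [ENNReal.toReal_ofNat]
  calc ∫⁻ x, ‖((symmRearr g x).toReal : ℂ)‖ₑ ^ (2 : ℝ)
      = ∫⁻ x, ENNReal.ofReal ((symmRearr g x).toReal ^ (2 : ℝ)) := by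
        refine lintegral_congr fun x => ?_
        rw [hcv _ ENNReal.toReal_nonneg, ← ofReal_norm, Complex.norm_real, Real.norm_eq_abs,
          abs_of_nonneg ENNReal.toReal_nonneg]
    _ ≤ ∫⁻ x, ENNReal.ofReal (‖g x‖ ^ (2 : ℝ)) := hint
    _ = ∫⁻ x, ‖g x‖ₑ ^ (2 : ℝ) := by
        refine lintegral_congr fun x => ?_
        rw [hcv _ (norm_nonneg _), ofReal_norm]

/-- The Fourier rearrangement `f^♯ = 𝓕⁻¹ {(𝓕 f)^*}` of `f ∈ L²(ℝ^d)`. -/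
def fourierRearr {d : ℕ} [NeZero d] (f : L2 d) : L2 d :=
  𝓕⁻ ((memLp_symmRearr (𝓕 f : L2 d) (Lp.memLp (𝓕 f : L2 d))).toLp)

/-! ### Sobolev spaces -/

/-- The Sobolev space `H^s(ℝ^d)`, `s ≥ 0`, as a subset of `L²(ℝ^d)`. -/
def Hs (d : ℕ) (s : ℝ) : Set (L2 d) :=
  {f | TemperedDistribution.MemSobolev s 2 (f : 𝓢'(Space d, ℂ))}

/-- The norm `‖f‖_{H^s} = (∫ (1 + |2πξ|²)^s |(𝓕 f)(ξ)|² dξ)^{1/2}`, which is `∞` if `f ∉ H^s`. -/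
def sobolevNorm {d : ℕ} (s : ℝ) (f : L2 d) : ℝ≥0∞ :=
  (∫⁻ ξ, ENNReal.ofReal ((1 + ‖(2 * Real.pi) • ξ‖ ^ 2) ^ s) * ‖(𝓕 f : L2 d) ξ‖ₑ ^ 2) ^ (1 / 2 : ℝ)

/-- `H^{s,♯}(ℝ^d) = {f ∈ H^s(ℝ^d) : f = f^♯}`. -/
def HsSharp (d : ℕ) [NeZero d] (s : ℝ) : Set (L2 d) :=
  {f | f ∈ Hs d s ∧ f = fourierRearr f}

/-- The critical exponent: `2d/(d-2s)` if `s < d/2`, and `∞` if `s ≥ d/2`. -/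
def pStar (s : ℝ) (d : ℕ) : ℝ≥0∞ :=
  if s < d / 2 then ENNReal.ofReal (2 * d / (d - 2 * s)) else ∞

/-- A subset `K` of `H^s(ℝ^d)` is compactly embedded in `L^p(ℝ^d)`: it is contained in `L^p`, the
inclusion is Lipschitz for the two norms, and each sequence in `K` that is bounded in `H^s` has a
subsequence that converges in `L^p`. -/
def CompactlyEmbedded {d : ℕ} (s : ℝ) (p : ℝ≥0∞) (K : Set (L2 d)) : Prop :=
  (∀ f ∈ K, MemLp f p volume) ∧
  (∃ C : ℝ≥0, ∀ f ∈ K, ∀ g ∈ K, eLpNorm (f - g : L2 d) p volume ≤ C * sobolevNorm s (f - g)) ∧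
  ∀ f : ℕ → L2 d, (∀ k, f k ∈ K) → (∃ M : ℝ≥0, ∀ k, sobolevNorm s (f k) ≤ M) →
    ∃ φ : ℕ → ℕ, StrictMono φ ∧ ∃ h : Space d → ℂ, MemLp h p volume ∧
      Tendsto (fun m => eLpNorm (fun x => f (φ m) x - h x) p volume) atTop (𝓝 0)

end FourierRearr

end

/-! For f = f^♯ the Fourier transform is radially decreasing, so the problem becomes one about
monotone profiles on a half-line, where compactness is cheap. Monotonicity and an H^s bound M give,
by averaging over a ball of size |ξ| just inside radius |ξ|, the pointwise bound C(M)
(1+|ξ|²)^{-s/2} |ξ|^{-d/2}. Helly selection yields a subsequence whose Fourier transforms converge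
almost everywhere to a radially decreasing limit; Fatou keeps its energy finite, and its inverse
transform lies in H^{s,♯}.

Let q = p/(p-1). The envelope lies in L^q exactly because 2 < p < p_*: p > 2 gives integrability at
the origin and p < p_* at infinity. Dominated convergence then gives convergence of the Fourier
transforms in L^q, and Hausdorff–Young, L^q → L^p, carries it back. Since p enters only after the
subsequence has been chosen, one subsequence serves all p.

The Sobolev embedding comes from the same Hausdorff–Young bound and Hölder against the weight. -/

noncomputable section

namespace FourierRearr

variable {d : ℕ}

/-! ### Endpoint bounds for the inverse Fourier transform -/

/-- On `L¹ ∩ L²`, the inverse Fourier transform of `L²` is bounded by the `L¹` norm. -/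
theorem norm_fourierInv_le_integral_norm (v : L2 d) (hv : Integrable v volume) :
    ∀ᵐ x, ‖(𝓕⁻ v : L2 d) x‖ ≤ ∫ ξ, ‖v ξ‖ := by
  -- `VectorFourier.fourierIntegral` has kernel e(-L), so the sign produces the inverse transform.
  set L : Space d →ₗ[ℝ] Space d →ₗ[ℝ] ℝ := -innerₗ (Space d)
  have hL : Continuous fun p : Space d × Space d => L p.1 p.2 := by
    simp only [L, LinearMap.neg_apply, innerₗ_apply_apply]
    fun_prop
  have hflip : L.flip = L := by
    ext x y
    simp [L, real_inner_comm]
  set w : Space d → ℂ := VectorFourier.fourierIntegral Real.fourierChar volume L v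
  have hw : Continuous w :=
    VectorFourier.fourierIntegral_continuous Real.continuous_fourierChar hL hv
  -- The L² transform agrees with the distributional one, defined by duality. Pairing with a test
  -- function and moving the integral transform across by Fubini identifies it with w.
  have key : ∀ᵐ x, (𝓕⁻ v : L2 d) x = w x := by
    refine ae_eq_of_integral_contDiff_smul_eq
      ((Lp.memLp (𝓕⁻ v : L2 d)).locallyIntegrable (by norm_num)) hw.locallyIntegrable
      fun g hg hgc => ?_
    have hg₁ : HasCompactSupport (Complex.ofRealCLM ∘ g) := hgc.comp_left rfl
    have hg₂ : ContDiff ℝ ((⊤ : ℕ∞) : WithTop ℕ∞) (Complex.ofRealCLM ∘ g) :=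
      Complex.ofRealCLM.contDiff.comp hg
    set G : 𝓢(Space d, ℂ) := hg₁.toSchwartzMap hg₂
    have hG : ∀ x, G x = (g x : ℂ) := fun x => rfl
    have hGi : ∀ x, (𝓕⁻ G : 𝓢(Space d, ℂ)) x
        = VectorFourier.fourierIntegral Real.fourierChar volume L G x := by
      intro x
      rw [SchwartzMap.fourierInv_coe, Real.fourierInv_eq]
      simp [VectorFourier.fourierIntegral, L]
    have h1 : ((𝓕⁻ v : L2 d) : 𝓢'(Space d, ℂ)) G = (v : 𝓢'(Space d, ℂ)) (𝓕⁻ G) := by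
      rw [← Lp.fourierInv_toTemperedDistribution_eq]
      rfl
    rw [Lp.toTemperedDistribution_apply, Lp.toTemperedDistribution_apply] at h1
    have h2 := VectorFourier.integral_fourierIntegral_smul_eq_flip (L := L)
      Real.continuous_fourierChar hL (G.integrable (μ := volume)) hv
    rw [hflip] at h2
    simp only [hGi, h2, hG] at h1
    simpa using h1
  filter_upwards [key] with x hx
  rw [hx]
  exact VectorFourier.norm_fourierIntegral_le_integral_norm _ _ _ _ _

/-- Plancherel's theorem. -/
theorem lintegral_enorm_sq_fourierInv (v : L2 d) :
    ∫⁻ x, ‖(𝓕⁻ v : L2 d) x‖ₑ ^ 2 = ∫⁻ ξ, ‖v ξ‖ₑ ^ 2 := by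
  have h (f : L2 d) : ∫⁻ x, ‖f x‖ₑ ^ 2 = ‖f‖ₑ ^ 2 := by
    rw [Lp.enorm_def, eLpNorm_eq_lintegral_rpow_enorm_toReal two_ne_zero ENNReal.ofNat_ne_top,
      ← ENNReal.rpow_natCast, ← ENNReal.rpow_mul]
    simp
  have hn : ‖(𝓕⁻ v : L2 d)‖ = ‖v‖ := (Lp.fourierTransformₗᵢ (Space d) ℂ).symm.norm_map v
  rw [h, h, ← ofReal_norm, ← ofReal_norm, hn]

/-! ### Fourier description of H^s -/

/-- The weight `(1 + |2πξ|²)^s`. -/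
def weight (s : ℝ) (ξ : Space d) : ℝ := (1 + ‖(2 * Real.pi) • ξ‖ ^ 2) ^ s

theorem weight_pos (s : ℝ) (ξ : Space d) : 0 < weight s ξ := by unfold weight; positivity

theorem measurable_weight (s : ℝ) : Measurable (weight s : Space d → ℝ) := by
  unfold weight; fun_prop

theorem one_add_norm_sq_le (ξ : Space d) : 1 + ‖ξ‖ ^ 2 ≤ 1 + ‖(2 * Real.pi) • ξ‖ ^ 2 := by
  rw [norm_smul, Real.norm_eq_abs, abs_of_pos Real.two_pi_pos, mul_pow]
  have : 1 ≤ (2 * Real.pi) ^ 2 := one_le_pow₀ (by linarith [Real.pi_gt_three])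
  nlinarith [sq_nonneg ‖ξ‖]

theorem one_add_norm_sq_ge (ξ : Space d) :
    1 + ‖(2 * Real.pi) • ξ‖ ^ 2 ≤ (2 * Real.pi) ^ 2 * (1 + ‖ξ‖ ^ 2) := by
  rw [norm_smul, Real.norm_eq_abs, abs_of_pos Real.two_pi_pos, mul_pow]
  have : 1 ≤ (2 * Real.pi) ^ 2 := one_le_pow₀ (by linarith [Real.pi_gt_three])
  linarith

theorem rpow_le_weight {s : ℝ} (hs : 0 ≤ s) (ξ : Space d) : (1 + ‖ξ‖ ^ 2) ^ s ≤ weight s ξ :=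
  Real.rpow_le_rpow (by positivity) (one_add_norm_sq_le ξ) hs

theorem weight_le_mul_rpow {s : ℝ} (hs : 0 ≤ s) (ξ : Space d) :
    weight s ξ ≤ ((2 * Real.pi) ^ 2) ^ s * (1 + ‖ξ‖ ^ 2) ^ s := by
  rw [← Real.mul_rpow (by positivity) (by positivity)]
  exact Real.rpow_le_rpow (by positivity) (one_add_norm_sq_ge ξ) hs

/-- The squared Sobolev norm in terms of the Fourier transform. -/
def energy (s : ℝ) (u : Space d → ℂ) : ℝ≥0∞ :=
  ∫⁻ ξ, ENNReal.ofReal (weight s ξ) * ‖u ξ‖ₑ ^ 2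

theorem sobolevNorm_eq (s : ℝ) (f : L2 d) :
    sobolevNorm s f = energy s (𝓕 f : L2 d) ^ (1 / 2 : ℝ) := rfl

theorem energy_congr_ae {s : ℝ} {u v : Space d → ℂ} (h : u =ᵐ[volume] v) :
    energy s u = energy s v := by
  refine lintegral_congr_ae ?_
  filter_upwards [h] with ξ hξ
  rw [hξ]

theorem memLp_two_of_energy {s : ℝ} (hs : 0 ≤ s) {u : Space d → ℂ} (hu : Measurable u)
    (h : energy s u < ∞) : MemLp u 2 volume := by
  refine ⟨hu.aestronglyMeasurable, ?_⟩
  rw [eLpNorm_lt_top_iff_lintegral_rpow_enorm_lt_top two_ne_zero ENNReal.ofNat_ne_top]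
  refine lt_of_le_of_lt (lintegral_mono fun ξ => ?_) h
  simp only [ENNReal.toReal_ofNat, ENNReal.rpow_ofNat]
  refine le_mul_of_one_le_left zero_le ?_
  rw [ENNReal.one_le_ofReal]
  exact Real.one_le_rpow (by nlinarith [sq_nonneg ‖(2 * Real.pi) • ξ‖]) hs

/-- The Bessel weight as a complex-valued function. -/
def bessel (s : ℝ) (ξ : Space d) : ℂ := ((1 + ‖ξ‖ ^ 2) ^ (s / 2) : ℝ)

theorem bessel_hasTemperateGrowth (s : ℝ) :
    (bessel s : Space d → ℂ).HasTemperateGrowth := by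
  unfold bessel; fun_prop

theorem enorm_bessel_sq (s : ℝ) (ξ : Space d) :
    ‖bessel s ξ‖ₑ ^ 2 = ENNReal.ofReal ((1 + ‖ξ‖ ^ 2) ^ s) := by
  have h : 0 ≤ (1 + ‖ξ‖ ^ 2) ^ (s / 2) := by positivity
  rw [bessel, ← ofReal_norm, Complex.norm_real, Real.norm_of_nonneg h,
    ← ENNReal.ofReal_pow h, ← Real.rpow_mul_natCast (by positivity)]
  norm_num

/-- `MemSobolev` speaks of a product of tempered distributions. That product is represented by the
pointwise product, which is locally integrable and hence determined almost everywhere by test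
functions. -/
theorem mem_Hs_iff_memLp (s : ℝ) (f : L2 d) :
    f ∈ Hs d s ↔ MemLp (fun ξ => bessel s ξ * (𝓕 f : L2 d) ξ) 2 volume := by
  have happ : ∀ g : 𝓢(Space d, ℂ),
      TemperedDistribution.smulLeftCLM ℂ (bessel s) (𝓕 (f : 𝓢'(Space d, ℂ))) g
        = ∫ ξ, g ξ • (bessel s ξ * (𝓕 f : L2 d) ξ) := by
    intro g
    rw [Lp.fourier_toTemperedDistribution_eq, TemperedDistribution.smulLeftCLM_apply_apply,
      Lp.toTemperedDistribution_apply]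
    refine integral_congr_ae (Eventually.of_forall fun ξ => ?_)
    simp only [SchwartzMap.smulLeftCLM_apply_apply (bessel_hasTemperateGrowth s), smul_eq_mul]
    ring
  have hiff : f ∈ Hs d s ↔ ∃ f' : L2 d,
      TemperedDistribution.smulLeftCLM ℂ (bessel s) (𝓕 (f : 𝓢'(Space d, ℂ)))
        = (f' : 𝓢'(Space d, ℂ)) :=
    TemperedDistribution.memSobolev_iff_exists_smulLeftCLM_fourier
  rw [hiff]
  constructor
  · rintro ⟨f', hf'⟩
    have hcont : Continuous (bessel s : Space d → ℂ) := (bessel_hasTemperateGrowth s).1.continuous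
    have hae : ∀ᵐ ξ, bessel s ξ * (𝓕 f : L2 d) ξ = f' ξ := by
      refine ae_eq_of_integral_contDiff_smul_eq ?_
        ((Lp.memLp f').locallyIntegrable (by norm_num)) fun g hg hgc => ?_
      · exact ((Lp.memLp (𝓕 f : L2 d)).locallyIntegrable (by norm_num)).continuous_mul hcont
      · have hg₁ : HasCompactSupport (Complex.ofRealCLM ∘ g) := hgc.comp_left rfl
        have hg₂ : ContDiff ℝ ((⊤ : ℕ∞) : WithTop ℕ∞) (Complex.ofRealCLM ∘ g) :=
          Complex.ofRealCLM.contDiff.comp hg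
        have h := happ (hg₁.toSchwartzMap hg₂)
        rw [hf', Lp.toTemperedDistribution_apply] at h
        simpa using h.symm
    exact (memLp_congr_ae hae).mpr (Lp.memLp f')
  · intro h
    refine ⟨h.toLp, ?_⟩
    ext g
    rw [happ, Lp.toTemperedDistribution_apply]
    refine integral_congr_ae ?_
    filter_upwards [h.coeFn_toLp] with ξ hξ
    rw [hξ]

/-- The Bessel weight carries no 2π. The two weights are comparable within a factor (2π)^{2s}, so
finiteness is the same for both. -/
theorem mem_Hs_iff_energy {s : ℝ} (hs : 0 ≤ s) (f : L2 d) :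
    f ∈ Hs d s ↔ energy s (𝓕 f : L2 d) < ∞ := by
  have hcont : Continuous (bessel s : Space d → ℂ) := (bessel_hasTemperateGrowth s).1.continuous
  have hm : AEStronglyMeasurable (fun ξ => bessel s ξ * (𝓕 f : L2 d) ξ) volume :=
    hcont.aestronglyMeasurable.mul (Lp.aestronglyMeasurable _)
  have hn : eLpNorm (fun ξ => bessel s ξ * (𝓕 f : L2 d) ξ) 2 volume < ∞ ↔
      ∫⁻ ξ, ENNReal.ofReal ((1 + ‖ξ‖ ^ 2) ^ s) * ‖(𝓕 f : L2 d) ξ‖ₑ ^ 2 < ∞ := by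
    rw [eLpNorm_lt_top_iff_lintegral_rpow_enorm_lt_top two_ne_zero ENNReal.ofNat_ne_top]
    simp [mul_pow, enorm_bessel_sq]
  rw [mem_Hs_iff_memLp, MemLp, and_iff_right hm, hn, energy]
  constructor <;> intro h
  · refine lt_of_le_of_lt (lintegral_mono fun ξ => ?_)
      ((lintegral_const_mul' (ENNReal.ofReal (((2 * Real.pi) ^ 2) ^ s)) _
        ENNReal.ofReal_ne_top).trans_lt (ENNReal.mul_lt_top ENNReal.ofReal_lt_top h))
    dsimp only
    rw [← mul_assoc, ← ENNReal.ofReal_mul (by positivity)]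
    gcongr
    exact weight_le_mul_rpow hs ξ
  · refine lt_of_le_of_lt (lintegral_mono fun ξ => ?_) h
    gcongr
    exact rpow_le_weight hs ξ

/-! ### Hausdorff–Young by real interpolation -/

/-- Splitting `v` at a height depending on `t` bounds the distribution function of `𝓕⁻ v`. -/
theorem volume_lt_norm_fourierInv_le (v : L2 d) {a N t : ℝ} (hN : 0 < N) (ht : 0 < t)
    (hv : ∫⁻ ξ, ‖v ξ‖ₑ ^ (1 + a) ≤ ENNReal.ofReal N) :
    volume {x | t < ‖(𝓕⁻ v : L2 d) x‖} ≤
      ENNReal.ofReal (4 / t ^ 2) * ∫⁻ ξ in {ξ | t * ‖v ξ‖ ^ a ≤ 2 * N}, ‖v ξ‖ₑ ^ 2 := by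
  have hvm : Measurable (v : Space d → ℂ) := (Lp.stronglyMeasurable v).measurable
  -- Off A, |v| ≤ (t/2N)|v|^{1+a}, so that part has L¹ norm at most t/2 and its transform is at most
  -- t/2. Where |𝓕⁻ v| > t, the part on A must contribute at least t/2; Chebyshev and Plancherel
  -- give the factor 4/t².
  set A : Set (Space d) := {ξ | t * ‖v ξ‖ ^ a ≤ 2 * N}
  have hA : MeasurableSet A := measurableSet_le (by fun_prop) measurable_const
  have h1 : MemLp (Aᶜ.indicator v) 2 volume := (Lp.memLp v).indicator hA.compl
  have h2 : MemLp (A.indicator v) 2 volume := (Lp.memLp v).indicator hA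
  have hInt : ∫⁻ ξ, ‖Aᶜ.indicator v ξ‖ₑ ≤ ENNReal.ofReal (t / 2) := by
    calc ∫⁻ ξ, ‖Aᶜ.indicator v ξ‖ₑ
        ≤ ∫⁻ ξ, ENNReal.ofReal (t / (2 * N)) * ‖v ξ‖ₑ ^ (1 + a) := by
          refine lintegral_mono fun ξ => ?_
          by_cases hξ : ξ ∈ A
          · simp [hξ]
          · have hξ' : 2 * N < t * ‖v ξ‖ ^ a := not_le.mp hξ
            rw [indicator_of_mem (mem_compl hξ)]
            rcases eq_or_ne (v ξ) 0 with h0 | h0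
            · simp [h0]
            have hpos : 0 < ‖v ξ‖ := norm_pos_iff.mpr h0
            rw [← ofReal_norm, ENNReal.ofReal_rpow_of_pos hpos,
              ← ENNReal.ofReal_mul (by positivity), Real.rpow_add hpos, Real.rpow_one]
            refine ENNReal.ofReal_le_ofReal ?_
            rw [div_mul_eq_mul_div, le_div_iff₀ (by positivity)]
            nlinarith
      _ = ENNReal.ofReal (t / (2 * N)) * ∫⁻ ξ, ‖v ξ‖ₑ ^ (1 + a) :=
          lintegral_const_mul' _ _ ENNReal.ofReal_ne_top
      _ ≤ ENNReal.ofReal (t / (2 * N)) * ENNReal.ofReal N := by gcongr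
      _ = ENNReal.ofReal (t / 2) := by
          rw [← ENNReal.ofReal_mul (by positivity)]
          congr 1
          field_simp
  have hi1 : Integrable (h1.toLp : L2 d) volume := by
    rw [integrable_congr h1.coeFn_toLp]
    exact ⟨h1.1, hInt.trans_lt ENNReal.ofReal_lt_top⟩
  have hnorm : ∫ ξ, ‖(h1.toLp : L2 d) ξ‖ ≤ t / 2 := by
    rw [integral_norm_eq_lintegral_enorm (Lp.aestronglyMeasurable _)]
    refine ENNReal.toReal_le_of_le_ofReal (by positivity) ?_
    refine (lintegral_congr_ae ?_).trans_le hInt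
    filter_upwards [h1.coeFn_toLp] with ξ hξ
    rw [hξ]
  have hsum : v = h1.toLp + h2.toLp := by
    rw [← MemLp.toLp_add]
    refine Lp.ext ?_
    filter_upwards [(h1.add h2).coeFn_toLp] with ξ hξ
    rw [hξ, Set.indicator_compl_add_self]
  have hfsum : (𝓕⁻ v : L2 d) = 𝓕⁻ (h1.toLp : L2 d) + 𝓕⁻ (h2.toLp : L2 d) := by
    conv_lhs => rw [hsum]
    exact FourierTransform.fourierInv_add _ _
  have hsub : ∀ᵐ x, t < ‖(𝓕⁻ v : L2 d) x‖ →
      ENNReal.ofReal ((t / 2) ^ 2) ≤ ‖(𝓕⁻ (h2.toLp : L2 d) : L2 d) x‖ₑ ^ 2 := by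
    rw [hfsum]
    filter_upwards [norm_fourierInv_le_integral_norm _ hi1,
      Lp.coeFn_add (𝓕⁻ (h1.toLp : L2 d)) (𝓕⁻ (h2.toLp : L2 d))] with x hx hadd hlt
    rw [hadd, Pi.add_apply] at hlt
    have := norm_add_le ((𝓕⁻ (h1.toLp : L2 d) : L2 d) x) ((𝓕⁻ (h2.toLp : L2 d) : L2 d) x)
    rw [← ofReal_norm, ← ENNReal.ofReal_pow (norm_nonneg _)]
    gcongr
    linarith
  have hmk := mul_meas_ge_le_lintegral₀ (μ := volume)
    (f := fun x => ‖(𝓕⁻ (h2.toLp : L2 d) : L2 d) x‖ₑ ^ 2)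
    ((Lp.aestronglyMeasurable _).enorm.pow_const 2) (ENNReal.ofReal ((t / 2) ^ 2))
  have hpl : ∫⁻ x, ‖(𝓕⁻ (h2.toLp : L2 d) : L2 d) x‖ₑ ^ 2 = ∫⁻ ξ in A, ‖v ξ‖ₑ ^ 2 := by
    rw [lintegral_enorm_sq_fourierInv, ← lintegral_indicator hA]
    refine lintegral_congr_ae ?_
    filter_upwards [h2.coeFn_toLp] with ξ hξ
    rw [hξ]
    by_cases h : ξ ∈ A <;> simp [h]
  rw [hpl] at hmk
  calc volume {x | t < ‖(𝓕⁻ v : L2 d) x‖}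
      ≤ volume {x | ENNReal.ofReal ((t / 2) ^ 2) ≤ ‖(𝓕⁻ (h2.toLp : L2 d) : L2 d) x‖ₑ ^ 2} :=
        measure_mono_ae hsub
    _ = ENNReal.ofReal (4 / t ^ 2) * (ENNReal.ofReal ((t / 2) ^ 2) *
          volume {x | ENNReal.ofReal ((t / 2) ^ 2) ≤ ‖(𝓕⁻ (h2.toLp : L2 d) : L2 d) x‖ₑ ^ 2}) := by
        rw [← mul_assoc, ← ENNReal.ofReal_mul (by positivity)]
        have : 4 / t ^ 2 * (t / 2) ^ 2 = 1 := by field_simp; norm_num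
        rw [this, ENNReal.ofReal_one, one_mul]
    _ ≤ _ := by gcongr

theorem lintegral_Ioc_rpow {B r : ℝ} (hB : 0 ≤ B) (hr : -1 < r) :
    ∫⁻ t in Ioc 0 B, ENNReal.ofReal (t ^ r) = ENNReal.ofReal (B ^ (r + 1) / (r + 1)) := by
  rw [← ofReal_integral_eq_lintegral_ofReal, ← intervalIntegral.integral_of_le hB,
    integral_rpow (Or.inl hr), Real.zero_rpow (by linarith), sub_zero]
  · exact (intervalIntegrable_iff_integrableOn_Ioc_of_le hB).mp
      (intervalIntegral.intervalIntegrable_rpow' hr)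
  · refine (ae_restrict_iff' measurableSet_Ioc).mpr (Eventually.of_forall fun t ht => ?_)
    exact Real.rpow_nonneg ht.1.le _

/-- A Hausdorff–Young inequality (with a constant), by interpolation of the `L¹ → L^∞` and
`L² → L²` bounds. -/
theorem lintegral_fourierInv_rpow_le {p : ℝ} (hp : 2 < p) (v : L2 d) :
    ∫⁻ x, ‖(𝓕⁻ v : L2 d) x‖ₑ ^ p ≤ ENNReal.ofReal (p * (4 * 2 ^ (p - 2) / (p - 2))) *
      (∫⁻ ξ, ‖v ξ‖ₑ ^ (p / (p - 1))) ^ (p - 1) := by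
  have hvm : Measurable (v : Space d → ℂ) := (Lp.stronglyMeasurable v).measurable
  have hfm : Measurable ((𝓕⁻ v : L2 d) : Space d → ℂ) := (Lp.stronglyMeasurable _).measurable
  -- The choice makes 1 + a the dual exponent and 2 - a(p-2) = 1 + a, the power of |v| left after
  -- integrating t^{p-3} up to 2N/|v|^a.
  set a : ℝ := 1 / (p - 1) with ha
  have hp1 : 0 < p - 1 := by linarith
  have hp2 : 0 < p - 2 := by linarith
  have ha0 : 0 < a := by positivity
  have hq : p / (p - 1) = 1 + a := by rw [ha]; field_simp; ring
  rw [hq]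
  set I : ℝ≥0∞ := ∫⁻ ξ, ‖v ξ‖ₑ ^ (1 + a) with hI
  have hK : 0 < p * (4 * 2 ^ (p - 2) / (p - 2)) := by positivity
  rcases eq_or_ne I ∞ with hIt | hIt
  · rw [hIt, ENNReal.top_rpow_of_pos hp1, ENNReal.mul_top (by simpa using hK)]
    exact le_top
  rcases eq_or_ne I 0 with hI0 | hI0
  · have hv0 : v = 0 := by
      rw [hI, lintegral_eq_zero_iff (by fun_prop)] at hI0
      refine Lp.ext ?_
      filter_upwards [hI0, Lp.coeFn_zero ℂ 2 (volume : Measure (Space d))] with ξ hξ h0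
      rw [h0]
      simp only [Pi.zero_apply, ENNReal.rpow_eq_zero_iff, enorm_eq_zero, enorm_ne_top,
        false_and, or_false] at hξ
      exact hξ.1
    have h0 : ∫⁻ x, ‖(𝓕⁻ v : L2 d) x‖ₑ ^ p = 0 := by
      rw [lintegral_eq_zero_iff (by fun_prop)]
      have hz : (𝓕⁻ v : L2 d) = 0 := by
        rw [hv0]; exact (Lp.fourierTransformₗᵢ (Space d) ℂ).symm.map_zero
      rw [hz]
      filter_upwards [Lp.coeFn_zero ℂ 2 (volume : Measure (Space d))] with ξ h0
      rw [h0]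
      simp [show 0 < p by linarith]
    rw [h0]
    exact zero_le
  set N : ℝ := I.toReal with hN
  have hN0 : 0 < N := ENNReal.toReal_pos hI0 hIt
  have hIN : I = ENNReal.ofReal N := (ENNReal.ofReal_toReal hIt).symm
  have hmeas : Measurable fun z : ℝ × Space d =>
      {z : ℝ × Space d | z.1 * ‖v z.2‖ ^ a ≤ 2 * N}.indicator
        (fun z => ENNReal.ofReal (4 * z.1 ^ (p - 3)) * ‖v z.2‖ₑ ^ 2) z := by
    refine Measurable.indicator (by fun_prop) (measurableSet_le (by fun_prop) measurable_const)
  calc ∫⁻ x, ‖(𝓕⁻ v : L2 d) x‖ₑ ^ p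
      = ∫⁻ x, ENNReal.ofReal (‖(𝓕⁻ v : L2 d) x‖ ^ p) := by
        refine lintegral_congr fun x => ?_
        rw [← ofReal_norm, ENNReal.ofReal_rpow_of_nonneg (norm_nonneg _) (by linarith)]
    _ = ENNReal.ofReal p * ∫⁻ t in Ioi 0, volume {x | t < ‖(𝓕⁻ v : L2 d) x‖} *
          ENNReal.ofReal (t ^ (p - 1)) :=
        lintegral_rpow_eq_lintegral_meas_lt_mul volume
          (Eventually.of_forall fun _ => norm_nonneg _) hfm.norm.aemeasurable (by linarith)
    _ ≤ ENNReal.ofReal p * ∫⁻ t in Ioi (0 : ℝ), ∫⁻ ξ,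
          {z : ℝ × Space d | z.1 * ‖v z.2‖ ^ a ≤ 2 * N}.indicator
            (fun z => ENNReal.ofReal (4 * z.1 ^ (p - 3)) * ‖v z.2‖ₑ ^ 2) (t, ξ) := by
        gcongr ENNReal.ofReal p * ?_
        refine setLIntegral_mono' measurableSet_Ioi fun t ht => ?_
        have ht : 0 < t := ht
        have hA : MeasurableSet {ξ | t * ‖v ξ‖ ^ a ≤ 2 * N} :=
          measurableSet_le (by fun_prop) measurable_const
        calc volume {x | t < ‖(𝓕⁻ v : L2 d) x‖} * ENNReal.ofReal (t ^ (p - 1))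
            ≤ (ENNReal.ofReal (4 / t ^ 2) *
                ∫⁻ ξ in {ξ | t * ‖v ξ‖ ^ a ≤ 2 * N}, ‖v ξ‖ₑ ^ 2) *
                ENNReal.ofReal (t ^ (p - 1)) := by
              gcongr
              exact volume_lt_norm_fourierInv_le v hN0 ht hIN.le
          _ = ENNReal.ofReal (4 * t ^ (p - 3)) *
                ∫⁻ ξ in {ξ | t * ‖v ξ‖ ^ a ≤ 2 * N}, ‖v ξ‖ₑ ^ 2 := by
              rw [mul_right_comm, ← ENNReal.ofReal_mul (by positivity)]
              congr 2
              rw [show p - 1 = (p - 3) + (2 : ℕ) by push_cast; ring, Real.rpow_add ht,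
                Real.rpow_natCast]
              field_simp
          _ = _ := by
              rw [← lintegral_const_mul' _ _ ENNReal.ofReal_ne_top, ← lintegral_indicator hA]
              rfl
    -- Tonelli: for fixed ξ the cut becomes an upper limit on t, and p > 2 makes t^{p-3} integrable
    -- at 0.
    _ = ENNReal.ofReal p * ∫⁻ ξ, ∫⁻ t in Ioi (0 : ℝ),
          {z : ℝ × Space d | z.1 * ‖v z.2‖ ^ a ≤ 2 * N}.indicator
            (fun z => ENNReal.ofReal (4 * z.1 ^ (p - 3)) * ‖v z.2‖ₑ ^ 2) (t, ξ) := by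
        rw [lintegral_lintegral_swap hmeas.aemeasurable]
    _ ≤ ENNReal.ofReal p * ∫⁻ ξ, ENNReal.ofReal (4 * (2 * N) ^ (p - 2) / (p - 2)) *
          ‖v ξ‖ₑ ^ (1 + a) := by
        gcongr ENNReal.ofReal p * ?_
        refine lintegral_mono fun ξ => ?_
        rcases eq_or_ne (v ξ) 0 with h0 | h0
        · refine le_of_eq_of_le ?_ zero_le
          simp [indicator, h0]
        have hb : 0 < ‖v ξ‖ := norm_pos_iff.mpr h0
        have hba : 0 < ‖v ξ‖ ^ a := by positivity
        have hp3 : 0 < p - 3 + 1 := by linarith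
        refine le_of_eq ?_
        calc ∫⁻ t in Ioi (0 : ℝ), {z : ℝ × Space d | z.1 * ‖v z.2‖ ^ a ≤ 2 * N}.indicator
              (fun z => ENNReal.ofReal (4 * z.1 ^ (p - 3)) * ‖v z.2‖ₑ ^ 2) (t, ξ)
            = ∫⁻ t in Ioi (0 : ℝ), (Iic (2 * N / ‖v ξ‖ ^ a)).indicator
                (fun t => ENNReal.ofReal (4 * t ^ (p - 3)) * ‖v ξ‖ₑ ^ 2) t := by
              refine lintegral_congr fun t => ?_
              simp only [indicator, mem_ofPred_eq, mem_Iic, le_div_iff₀ hba]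
          _ = ∫⁻ t in Ioc 0 (2 * N / ‖v ξ‖ ^ a),
                ENNReal.ofReal (4 * t ^ (p - 3)) * ‖v ξ‖ₑ ^ 2 := by
              rw [setLIntegral_indicator measurableSet_Iic, inter_comm, Ioi_inter_Iic]
          _ = ENNReal.ofReal 4 * ENNReal.ofReal
                ((2 * N / ‖v ξ‖ ^ a) ^ (p - 3 + 1) / (p - 3 + 1)) * ‖v ξ‖ₑ ^ 2 := by
              rw [lintegral_mul_const' _ _ (by simp), ← lintegral_Ioc_rpow (by positivity)
                (by linarith), ← lintegral_const_mul' _ _ ENNReal.ofReal_ne_top]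
              simp_rw [ENNReal.ofReal_mul (show (0 : ℝ) ≤ 4 by norm_num)]
          _ = ENNReal.ofReal (4 * (2 * N) ^ (p - 2) / (p - 2)) * ‖v ξ‖ₑ ^ (1 + a) := by
              rw [← ofReal_norm, ← ENNReal.ofReal_pow hb.le, ENNReal.ofReal_rpow_of_pos hb,
                ← ENNReal.ofReal_mul (by norm_num), ← ENNReal.ofReal_mul (by positivity),
                ← ENNReal.ofReal_mul (by positivity)]
              congr 1
              rw [show p - 3 + 1 = p - 2 by ring, Real.div_rpow (by positivity) hba.le,
                ← Real.rpow_mul hb.le]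
              have hexp : ‖v ξ‖ ^ 2 = ‖v ξ‖ ^ (1 + a) * ‖v ξ‖ ^ (a * (p - 2)) := by
                rw [← Real.rpow_add hb, ← Real.rpow_natCast]
                congr 1
                rw [ha]
                field_simp
                push_cast
                ring
              rw [hexp]
              field_simp
    _ = ENNReal.ofReal (p * (4 * 2 ^ (p - 2) / (p - 2))) * I ^ (p - 1) := by
        rw [lintegral_const_mul' _ _ ENNReal.ofReal_ne_top, ← hI, hIN,
          ENNReal.ofReal_rpow_of_pos hN0, ← ENNReal.ofReal_mul (by positivity),
          ← ENNReal.ofReal_mul (by positivity), ← ENNReal.ofReal_mul (by positivity)]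
        congr 1
        rw [Real.mul_rpow (by norm_num) hN0.le, show p - 1 = (p - 2) + 1 by ring,
          Real.rpow_add hN0, Real.rpow_one]
        field_simp

/-! ### Subcritical Sobolev embedding -/

/-- The product form treats s < d/2 and s ≥ d/2 together; in the latter case its left side is
nonpositive. -/
theorem lt_pStar {s : ℝ} {p : ℝ≥0∞} [NeZero d] (hp : p < pStar s d) :
    p ≠ ∞ ∧ p.toReal * (d - 2 * s) < 2 * d := by
  refine ⟨hp.ne_top, ?_⟩
  have hd : (0 : ℝ) < d := Nat.cast_pos.mpr (Nat.pos_of_ne_zero (NeZero.ne d))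
  unfold pStar at hp
  split_ifs at hp with h
  · have h' : 0 < (d : ℝ) - 2 * s := by linarith
    rw [ENNReal.lt_ofReal_iff_toReal_lt hp.ne_top, lt_div_iff₀ h'] at hp
    exact hp
  · have h' : (d : ℝ) - 2 * s ≤ 0 := by linarith
    have := mul_nonpos_of_nonneg_of_nonpos (ENNReal.toReal_nonneg (a := p)) h'
    linarith

/-- Hölder's inequality: the energy controls an `L^q` norm with `q < 2`. -/
theorem exists_lintegral_rpow_le_energy {s p : ℝ} (hs : 0 < s) (hp : 2 < p)
    (hpd : p * (d - 2 * s) < 2 * d) :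
    ∃ K : ℝ≥0, ∀ v : Space d → ℂ, Measurable v →
      ∫⁻ ξ, ‖v ξ‖ₑ ^ (p / (p - 1)) ≤ K * energy s v ^ (p / (p - 1) / 2) := by
  have hp1 : 0 < p - 1 := by linarith
  have hp2 : 0 < p - 2 := by linarith
  have hp0 : 0 < p := by linarith
  set q := p / (p - 1) with hq
  have hq0 : 0 < q := by positivity
  -- Q is the Hölder conjugate of 2/q, and qQ/2 = p/(p-2).
  set Q := 2 * (p - 1) / (p - 2) with hQ
  have hQ0 : 0 < Q := by positivity
  have hconj : (2 / q).HolderConjugate Q := by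
    refine ⟨?_, by positivity, hQ0⟩
    rw [hq, hQ]
    field_simp
    ring
  have hJ : ∫⁻ ξ : Space d, (ENNReal.ofReal (weight s ξ) ^ (-(q / 2))) ^ Q ≠ ∞ := by
    -- Integrability of (1+|ξ|²)^{-sp/(p-2)} requires d < 2sp/(p-2), which is p(d-2s) < 2d
    -- rearranged.
    have hr : (Module.finrank ℝ (Space d) : ℝ) < 2 * s * (p / (p - 2)) := by
      rw [finrank_euclideanSpace_fin, ← mul_div_assoc, lt_div_iff₀ hp2]
      nlinarith
    have hInt := (integrable_rpow_neg_one_add_norm_sq (E := Space d) (μ := volume) hr)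
    refine (lt_of_le_of_lt (lintegral_mono fun ξ => ?_) hInt.lintegral_lt_top).ne
    rw [← ENNReal.rpow_mul, ENNReal.ofReal_rpow_of_pos (weight_pos s ξ)]
    refine ENNReal.ofReal_le_ofReal ?_
    have he : -(q / 2) * Q = -(p / (p - 2)) := by
      rw [hq, hQ]
      field_simp
    rw [he]
    calc weight s ξ ^ (-(p / (p - 2)))
        ≤ ((1 + ‖ξ‖ ^ 2) ^ s) ^ (-(p / (p - 2))) :=
          Real.rpow_le_rpow_of_nonpos (by positivity) (rpow_le_weight hs.le ξ)
            (neg_nonpos.mpr (by positivity))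
      _ = (1 + ‖ξ‖ ^ 2) ^ (-(2 * s * (p / (p - 2))) / 2) := by
          rw [← Real.rpow_mul (by positivity)]
          congr 1
          ring
  refine ⟨((∫⁻ ξ : Space d, (ENNReal.ofReal (weight s ξ) ^ (-(q / 2))) ^ Q) ^ (1 / Q)).toNNReal,
    fun v hv => ?_⟩
  have hwm : Measurable fun ξ : Space d => ENNReal.ofReal (weight s ξ) :=
    (measurable_weight s).ennreal_ofReal
  rw [ENNReal.coe_toNNReal (ENNReal.rpow_ne_top_of_nonneg (by positivity) hJ), mul_comm]
  set f : Space d → ℝ≥0∞ := fun ξ => (ENNReal.ofReal (weight s ξ) * ‖v ξ‖ₑ ^ 2) ^ (q / 2) with hf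
  set g : Space d → ℝ≥0∞ := fun ξ => ENNReal.ofReal (weight s ξ) ^ (-(q / 2)) with hg
  calc ∫⁻ ξ, ‖v ξ‖ₑ ^ q
      = ∫⁻ ξ, (f * g) ξ := by
        refine lintegral_congr fun ξ => ?_
        have hw : ENNReal.ofReal (weight s ξ) ≠ 0 := by simpa using weight_pos s ξ
        simp only [Pi.mul_apply, hf, hg]
        rw [ENNReal.mul_rpow_of_nonneg _ _ (by positivity), mul_right_comm,
          ← ENNReal.rpow_add _ _ hw ENNReal.ofReal_ne_top, add_neg_cancel, ENNReal.rpow_zero,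
          one_mul, ← ENNReal.rpow_natCast, ← ENNReal.rpow_mul]
        congr 1
        push_cast
        ring
    _ ≤ _ := ENNReal.lintegral_mul_le_Lp_mul_Lq volume hconj (by fun_prop) (by fun_prop)
    _ = _ := by
        congr 1
        rw [energy, one_div_div]
        congr 1
        refine lintegral_congr fun ξ => ?_
        rw [← ENNReal.rpow_mul]
        field_simp
        simp

/-- The Hausdorff–Young inequality for norms. -/
theorem eLpNorm_fourierInv_le {p : ℝ≥0∞} (hp : 2 < p) (hpt : p ≠ ∞) :
    ∃ C : ℝ≥0, ∀ v : L2 d, eLpNorm (𝓕⁻ v : L2 d) p volume ≤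
      C * (∫⁻ ξ, ‖v ξ‖ₑ ^ (p.toReal / (p.toReal - 1))) ^ ((p.toReal - 1) / p.toReal) := by
  have hp2 : 2 < p.toReal := by
    simpa using (ENNReal.toReal_lt_toReal ENNReal.ofNat_ne_top hpt).mpr hp
  have hp0 : p ≠ 0 := (pos_of_gt hp).ne'
  refine ⟨((ENNReal.ofReal (p.toReal * (4 * 2 ^ (p.toReal - 2) / (p.toReal - 2)))) ^
    (1 / p.toReal)).toNNReal, fun v => ?_⟩
  rw [ENNReal.coe_toNNReal (ENNReal.rpow_ne_top_of_nonneg (by positivity) ENNReal.ofReal_ne_top),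
    eLpNorm_eq_lintegral_rpow_enorm_toReal hp0 hpt]
  refine (ENNReal.rpow_le_rpow (lintegral_fourierInv_rpow_le hp2 v) (by positivity)).trans_eq ?_
  rw [ENNReal.mul_rpow_of_nonneg _ _ (by positivity), ← ENNReal.rpow_mul, mul_one_div]

/-- The (subcritical) Sobolev embedding. -/
theorem exists_eLpNorm_le_sobolevNorm [NeZero d] {s : ℝ} (hs : 0 < s) {p : ℝ≥0∞} (hp : 2 < p)
    (hps : p < pStar s d) :
    ∃ C : ℝ≥0, ∀ f : L2 d, eLpNorm f p volume ≤ C * sobolevNorm s f := by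
  obtain ⟨hpt, hpd⟩ := lt_pStar hps
  have hp2 : 2 < p.toReal := by
    simpa using (ENNReal.toReal_lt_toReal ENNReal.ofNat_ne_top hpt).mpr hp
  obtain ⟨C, hC⟩ := eLpNorm_fourierInv_le (d := d) hp hpt
  obtain ⟨K, hK⟩ := exists_lintegral_rpow_le_energy hs hp2 hpd
  have hp1 : 0 < p.toReal - 1 := by linarith
  refine ⟨C * K ^ ((p.toReal - 1) / p.toReal), fun f => ?_⟩
  have hf := hC (𝓕 f)
  rw [FourierTransform.fourierInv_fourier_eq] at hf
  refine hf.trans ?_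
  rw [ENNReal.coe_mul, mul_assoc, sobolevNorm_eq]
  gcongr
  refine (ENNReal.rpow_le_rpow (hK _ (Lp.stronglyMeasurable _).measurable)
    (by positivity)).trans_eq ?_
  rw [ENNReal.mul_rpow_of_nonneg _ _ (by positivity), ← ENNReal.rpow_mul,
    ← ENNReal.coe_rpow_of_nonneg _ (by positivity)]
  congr 2
  field_simp

theorem sobolevNorm_lt_top {s : ℝ} (hs : 0 ≤ s) {f : L2 d} (hf : f ∈ Hs d s) :
    sobolevNorm s f < ∞ := by
  rw [sobolevNorm_eq]
  exact ENNReal.rpow_lt_top_of_nonneg (by norm_num) ((mem_Hs_iff_energy hs f).mp hf).ne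

/-! ### Radially decreasing functions and their envelope -/

/-- The radial function on `ℝ^d` with profile `U`. -/
def radial (d : ℕ) (U : ℝ → ℝ≥0∞) (ξ : Space d) : ℂ := ((U ‖ξ‖).toReal : ℂ)

/-- Profiles of radially decreasing functions, finite away from the origin. -/
structure IsProfile (U : ℝ → ℝ≥0∞) : Prop where
  antitone : Antitone U
  ne_top : ∀ r, 0 < r → U r ≠ ∞

theorem measurable_radial {U : ℝ → ℝ≥0∞} (hU : Antitone U) : Measurable (radial d U) :=
  Complex.measurable_ofReal.comp (hU.measurable.comp measurable_norm).ennreal_toReal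

/-- The origin is excluded because a profile may be ∞ there, and `toReal` sends ∞ to 0. -/
theorem IsProfile.enorm_radial {U : ℝ → ℝ≥0∞} (hU : IsProfile U) {ξ : Space d} (hξ : ξ ≠ 0) :
    ‖radial d U ξ‖ₑ = U ‖ξ‖ := by
  rw [radial, ← ofReal_norm, Complex.norm_real, Real.norm_of_nonneg ENNReal.toReal_nonneg,
    ENNReal.ofReal_toReal (hU.ne_top _ (norm_pos_iff.mpr hξ))]

/-- A radially decreasing function is bounded pointwise by its energy. -/
theorem IsProfile.sq_mul_le_energy {U : ℝ → ℝ≥0∞} (hU : IsProfile U) {s : ℝ} (hs : 0 ≤ s)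
    {ξ : Space d} (hξ : ξ ≠ 0) :
    U ‖ξ‖ ^ 2 * (ENNReal.ofReal ((1 + ‖ξ‖ ^ 2) ^ s * (‖ξ‖ / 4) ^ d) *
      volume (Metric.ball (0 : Space d) 1)) ≤ energy s (radial d U) := by
  have hr : 0 < ‖ξ‖ := norm_pos_iff.mpr hξ
  -- The ball of radius |ξ|/4 about 3ξ/4 lies in |ξ|/2 ≤ |y| ≤ |ξ|. There the profile is at least
  -- U(|ξ|), and 2π|y| ≥ |ξ| bounds the weight below.
  set c : Space d := (3 / 4 : ℝ) • ξ
  have hc : ‖c‖ = 3 / 4 * ‖ξ‖ := by rw [norm_smul, Real.norm_of_nonneg (by norm_num)]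
  have hy : ∀ y ∈ Metric.ball c (‖ξ‖ / 4), ENNReal.ofReal ((1 + ‖ξ‖ ^ 2) ^ s) * U ‖ξ‖ ^ 2 ≤
      ENNReal.ofReal (weight s y) * ‖radial d U y‖ₑ ^ 2 := by
    intro y hy
    rw [mem_ball_iff_norm] at hy
    have h1 : ‖y‖ ≤ ‖ξ‖ := by linarith [norm_le_norm_add_norm_sub' y c]
    have h2 : ‖ξ‖ / 2 ≤ ‖y‖ := by linarith [norm_le_norm_add_norm_sub' c y, norm_sub_rev y c]
    have hy0 : y ≠ 0 := norm_pos_iff.mp (by linarith)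
    rw [hU.enorm_radial hy0]
    gcongr
    · unfold weight
      rw [norm_smul, Real.norm_of_nonneg Real.two_pi_pos.le]
      gcongr
      nlinarith [Real.pi_gt_three]
    · exact hU.antitone h1
  calc _ = ENNReal.ofReal ((1 + ‖ξ‖ ^ 2) ^ s) * U ‖ξ‖ ^ 2 * volume (Metric.ball c (‖ξ‖ / 4)) := by
        rw [Measure.addHaar_ball_of_pos volume c (by positivity), finrank_euclideanSpace_fin,
          ENNReal.ofReal_mul (by positivity)]
        ring
    _ = ∫⁻ _ in Metric.ball c (‖ξ‖ / 4), ENNReal.ofReal ((1 + ‖ξ‖ ^ 2) ^ s) * U ‖ξ‖ ^ 2 := by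
        rw [setLIntegral_const]
    _ ≤ ∫⁻ y in Metric.ball c (‖ξ‖ / 4), ENNReal.ofReal (weight s y) * ‖radial d U y‖ₑ ^ 2 :=
        setLIntegral_mono' measurableSet_ball hy
    _ ≤ energy s (radial d U) := setLIntegral_le_lintegral _ _

/-- The envelope `(1 + |ξ|²)^{-s/2} |ξ|^{-d/2}` of the radially decreasing functions in `H^s`. -/
def envelope (s : ℝ) (ξ : Space d) : ℝ := (1 + ‖ξ‖ ^ 2) ^ (-s / 2) * ‖ξ‖ ^ (-(d : ℝ) / 2)

theorem envelope_nonneg (s : ℝ) (ξ : Space d) : 0 ≤ envelope s ξ := by unfold envelope; positivity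

/-- The averaging bound solved for U(|ξ|). The constant depends on the energy bound but not on the
profile, so the envelope is a common majorant for a whole sequence and its limit. -/
theorem exists_radial_le_envelope (d : ℕ) {s : ℝ} (hs : 0 ≤ s) (M : ℝ≥0) :
    ∃ C : ℝ≥0, ∀ U : ℝ → ℝ≥0∞, IsProfile U → energy s (radial d U) ≤ M → ∀ ξ : Space d, ξ ≠ 0 →
      U ‖ξ‖ ≤ C * ENNReal.ofReal (envelope s ξ) := by
  set b : ℝ≥0∞ := volume (Metric.ball (0 : Space d) 1) with hb
  have hb0 : b ≠ 0 := (Metric.measure_ball_pos volume 0 one_pos).ne'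
  have hbt : b ≠ ∞ := measure_ball_lt_top.ne
  set β : ℝ := b.toReal
  have hβ : 0 < β := ENNReal.toReal_pos hb0 hbt
  have hbβ : b = ENNReal.ofReal β := (ENNReal.ofReal_toReal hbt).symm
  refine ⟨Real.toNNReal √(M * 4 ^ d / β), fun U hU hE ξ hξ => ?_⟩
  have hr : 0 < ‖ξ‖ := norm_pos_iff.mpr hξ
  have h := (hU.sq_mul_le_energy hs hξ).trans hE
  set x : ℝ := (U ‖ξ‖).toReal
  have hx0 : 0 ≤ x := ENNReal.toReal_nonneg
  have hx : U ‖ξ‖ = ENNReal.ofReal x := (ENNReal.ofReal_toReal (hU.ne_top _ hr)).symm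
  rw [← hb, hbβ, hx, ← ENNReal.ofReal_pow hx0, ← ENNReal.ofReal_mul (by positivity),
    ← ENNReal.ofReal_mul (by positivity), ← ENNReal.ofReal_coe_nnreal] at h
  replace h := (ENNReal.ofReal_le_ofReal_iff M.2).mp h
  change U ‖ξ‖ ≤ ENNReal.ofReal √(M * 4 ^ d / β) * _
  rw [hx, ← ENNReal.ofReal_mul (by positivity)]
  refine ENNReal.ofReal_le_ofReal (le_of_sq_le_sq ?_
    (mul_nonneg (Real.sqrt_nonneg _) (envelope_nonneg s ξ)))
  have hen : envelope s ξ ^ 2 = ((1 + ‖ξ‖ ^ 2) ^ s * ‖ξ‖ ^ d)⁻¹ := by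
    rw [envelope, mul_pow, ← Real.rpow_mul_natCast (by positivity),
      ← Real.rpow_mul_natCast (by positivity), mul_inv, ← Real.rpow_neg (by positivity),
      ← Real.rpow_natCast ‖ξ‖ d, ← Real.rpow_neg (by positivity)]
    congr 2 <;> push_cast <;> ring
  rw [mul_pow, hen, Real.sq_sqrt (by positivity), ← div_eq_mul_inv,
    le_div_iff₀ (by positivity), le_div_iff₀ hβ]
  calc x ^ 2 * ((1 + ‖ξ‖ ^ 2) ^ s * ‖ξ‖ ^ d) * β
      = x ^ 2 * ((1 + ‖ξ‖ ^ 2) ^ s * (‖ξ‖ / 4) ^ d * β) * 4 ^ d := by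
        rw [div_pow]
        field_simp
    _ ≤ (M : ℝ) * 4 ^ d := mul_le_mul_of_nonneg_right h (by positivity)

/-- In polar coordinates the integrand is at most r^{d-1-dq/2} near 0, integrable as q < 2, and
r^{d-1-dq/2-sq} at infinity, integrable as q(d/2+s) > d. These conditions are p > 2 and p(d-2s) <
2d. -/
theorem lintegral_envelope_rpow_lt_top [NeZero d] {s p : ℝ} (hs : 0 < s) (hp : 2 < p)
    (hpd : p * (d - 2 * s) < 2 * d) :
    ∫⁻ ξ : Space d, ENNReal.ofReal (envelope s ξ) ^ (p / (p - 1)) < ∞ := by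
  have hd : 0 < d := Nat.pos_of_ne_zero (NeZero.ne d)
  have hd' : (0 : ℝ) < d := Nat.cast_pos.mpr hd
  have : Nonempty (Fin d) := ⟨⟨0, hd⟩⟩
  have hp1 : 0 < p - 1 := by linarith
  have hp0 : 0 < p := by linarith
  set q := p / (p - 1) with hq
  have hq0 : 0 < q := by positivity
  have hq2 : q < 2 := by
    rw [hq, div_lt_iff₀ hp1]
    linarith
  have hqd : (d : ℝ) < q * (d / 2 + s) := by
    rw [hq, div_mul_eq_mul_div, lt_div_iff₀ hp1]
    linarith
  have hsq : 0 < s * q := mul_pos hs hq0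
  set F : ℝ → ℝ := fun r => ((1 + r ^ 2) ^ (-s / 2) * r ^ (-(d : ℝ) / 2)) ^ q with hF
  have hFm : Measurable F := by fun_prop
  have hpos : ∀ r : ℝ, 0 < r → r ^ (d - 1) * F r
      = (1 + r ^ 2) ^ (-s / 2 * q) * r ^ ((d : ℝ) - 1 - d / 2 * q) := by
    intro r hr
    rw [hF]
    simp only
    rw [Real.mul_rpow (by positivity) (by positivity), ← Real.rpow_mul (by positivity),
      ← Real.rpow_mul hr.le, ← Real.rpow_natCast, Nat.cast_sub hd, mul_left_comm,
      ← Real.rpow_add hr]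
    congr 2
    push_cast
    ring
  have hInt : Integrable (fun ξ : Space d => F ‖ξ‖) volume := by
    rw [integrable_fun_norm_addHaar, finrank_euclideanSpace_fin, ← Ioc_union_Ioi_eq_Ioi zero_le_one]
    have hm : ∀ t : Set ℝ, AEStronglyMeasurable (fun y : ℝ => y ^ (d - 1) • F y)
        (volume.restrict t) := fun t => by
      simp only [smul_eq_mul]
      exact Measurable.aestronglyMeasurable (by fun_prop)
    refine IntegrableOn.union ?_ ?_
    · have h : IntegrableOn (fun r : ℝ => r ^ ((d : ℝ) - 1 - d / 2 * q)) (Ioc 0 1) :=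
        (intervalIntegrable_iff_integrableOn_Ioc_of_le zero_le_one).mp
          (intervalIntegral.intervalIntegrable_rpow' (by nlinarith))
      refine Integrable.mono' h (hm _) ?_
      refine (ae_restrict_iff' measurableSet_Ioc).mpr (Eventually.of_forall fun r hr => ?_)
      have hr0 : 0 < r := hr.1
      rw [smul_eq_mul, hpos r hr0, Real.norm_of_nonneg (by positivity)]
      refine mul_le_of_le_one_left (by positivity) ?_
      exact Real.rpow_le_one_of_one_le_of_nonpos (by nlinarith) (by nlinarith)
    · have h : IntegrableOn (fun r : ℝ => r ^ ((d : ℝ) - 1 - d / 2 * q - s * q)) (Ioi 1) :=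
        integrableOn_Ioi_rpow_of_lt (by nlinarith) one_pos
      refine Integrable.mono' h (hm _) ?_
      refine (ae_restrict_iff' measurableSet_Ioi).mpr (Eventually.of_forall fun r hr => ?_)
      have hr0 : 0 < r := one_pos.trans hr
      rw [smul_eq_mul, hpos r hr0, Real.norm_of_nonneg (by positivity), sub_eq_add_neg _ (s * q),
        Real.rpow_add hr0, mul_comm]
      refine mul_le_mul_of_nonneg_left ?_ (by positivity)
      calc (1 + r ^ 2) ^ (-s / 2 * q) ≤ (r ^ 2) ^ (-s / 2 * q) :=
            Real.rpow_le_rpow_of_nonpos (by positivity) (by linarith) (by nlinarith)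
        _ = r ^ (-(s * q)) := by
            rw [← Real.rpow_natCast, ← Real.rpow_mul hr0.le]
            congr 1
            push_cast
            ring
  refine (lintegral_congr fun ξ => ?_).trans_lt hInt.lintegral_lt_top
  rw [ENNReal.ofReal_rpow_of_nonneg (envelope_nonneg s ξ) hq0.le]
  rfl

/-! ### Helly selection -/

/-- Helly's selection theorem for antitone functions with values in `[0, ∞]`. -/
theorem exists_subseq_tendsto_of_antitone (U : ℕ → ℝ → ℝ≥0∞) (hU : ∀ k, Antitone (U k)) :
    ∃ φ : ℕ → ℕ, StrictMono φ ∧ ∃ V : ℝ → ℝ≥0∞, Antitone V ∧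
      (∀ r, ContinuousAt V r → Tendsto (fun m => U (φ m) r) atTop (𝓝 (V r))) ∧
      ∀ r' r c, r' < r → (∀ k, U k r' ≤ c) → V r ≤ c := by
  -- A countable power of [0,∞] is compact and metrizable, which replaces the diagonal argument.
  obtain ⟨L, φ, hφ, hL⟩ := CompactSpace.tendsto_subseq fun (k : ℕ) (q : ℚ) => U k q
  rw [tendsto_pi_nhds] at hL
  refine ⟨φ, hφ, fun r => ⨅ (q : ℚ) (_ : (q : ℝ) < r), L q, ?_, ?_, ?_⟩
  · intro r r' h
    exact le_iInf₂ fun q hq => iInf₂_le q (hq.trans_le h)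
  · intro r hr
    rw [tendsto_order]
    constructor
    · intro b hb
      -- Only the lower bound needs continuity: V stays above b slightly to the right of r, and a
      -- rational in between transfers this to the sequence.
      have hev := hr.eventually (lt_mem_nhds hb)
      obtain ⟨r', hr', hlt⟩ := ((hev.filter_mono nhdsWithin_le_nhds).and
        (self_mem_nhdsWithin (s := Ioi r))).exists
      obtain ⟨q, hq1, hq2⟩ := exists_rat_btwn hlt
      filter_upwards [(hL q).eventually (lt_mem_nhds (hr'.trans_le (iInf₂_le q hq2)))] with m hm
      exact hm.trans_le (hU _ hq1.le)
    · intro b hb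
      obtain ⟨q, hqb⟩ := iInf_lt_iff.mp hb
      obtain ⟨hq, hqb⟩ := iInf_lt_iff.mp hqb
      filter_upwards [(hL q).eventually (gt_mem_nhds hqb)] with m hm
      exact (hU _ hq.le).trans_lt hm
  · intro r' r c h hc
    obtain ⟨q, hq1, hq2⟩ := exists_rat_btwn h
    exact (iInf₂_le q hq2).trans
      (le_of_tendsto' (hL q) fun m => (hU _ hq1.le).trans (hc _))

/-! ### Rearrangements as radial profiles -/

/-- The profile of the symmetric-decreasing rearrangement. -/
def rearrProfile (g : Space d → ℂ) (r : ℝ) : ℝ≥0∞ :=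
  ∫⁻ t in Ioi (0 : ℝ), {t : ℝ | r < ballRadius {y | t < ‖g y‖}}.indicator 1 t

theorem indicator_one_le_indicator_one {A B : Set ℝ} {t : ℝ} (h : t ∈ A → t ∈ B) :
    A.indicator (1 : ℝ → ℝ≥0∞) t ≤ B.indicator 1 t := by
  by_cases hA : t ∈ A
  · simp [hA, h hA]
  · simp [hA]

theorem symmRearr_eq_rearrProfile (g : Space d → ℂ) (x : Space d) :
    symmRearr g x = rearrProfile g ‖x‖ := by
  refine lintegral_congr fun t => ?_
  simp only [indicator, setRearr, mem_ball_zero_iff, mem_ofPred_eq, Pi.one_apply]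

theorem antitone_rearrProfile (g : Space d → ℂ) : Antitone (rearrProfile g) := by
  intro r r' h
  refine lintegral_mono fun t => ?_
  exact indicator_le_indicator_of_subset (fun t ht => lt_of_le_of_lt h ht) (fun _ => zero_le) t

theorem ballRadius_ball [NeZero d] {r : ℝ} (hr : 0 ≤ r) :
    ballRadius (Metric.ball (0 : Space d) r) = r := by
  have hd : (d : ℝ) ≠ 0 := Nat.cast_ne_zero.mpr (NeZero.ne d)
  have : Nonempty (Fin d) := ⟨⟨0, Nat.pos_of_ne_zero (NeZero.ne d)⟩⟩
  rw [ballRadius, Measure.addHaar_ball volume 0 hr, finrank_euclideanSpace_fin,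
    ENNReal.mul_div_cancel_right (Metric.measure_ball_pos volume 0 one_pos).ne'
      measure_ball_lt_top.ne,
    ENNReal.toReal_ofReal (by positivity), ← Real.rpow_natCast, ← Real.rpow_mul hr,
    mul_inv_cancel₀ hd, Real.rpow_one]

theorem ballRadius_mono {A B : Set (Space d)} (h : volume A ≤ volume B) (hB : volume B ≠ ∞) :
    ballRadius A ≤ ballRadius B := by
  refine Real.rpow_le_rpow ENNReal.toReal_nonneg (ENNReal.toReal_mono ?_ ?_) (by positivity)
  · exact ENNReal.div_ne_top hB (Metric.measure_ball_pos volume 0 one_pos).ne'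
  · exact ENNReal.div_le_div_right h _

theorem volume_level_le {g : Space d → ℂ} (hg : MemLp g 2 volume) {τ : ℝ} (hτ : 0 < τ) :
    ENNReal.ofReal (τ ^ 2) * volume {y | τ < ‖g y‖} ≤ ∫⁻ y, ‖g y‖ₑ ^ 2 := by
  refine le_trans ?_ (mul_meas_ge_le_lintegral₀ (hg.1.enorm.pow_const 2) (ENNReal.ofReal (τ ^ 2)))
  gcongr with y
  intro hy
  rw [← ofReal_norm, ← ENNReal.ofReal_pow (norm_nonneg _)]
  gcongr

theorem lintegral_sq_lt_top {g : Space d → ℂ} (hg : MemLp g 2 volume) :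
    ∫⁻ y, ‖g y‖ₑ ^ 2 < ∞ := by
  have h := hg.2
  rw [eLpNorm_lt_top_iff_lintegral_rpow_enorm_lt_top two_ne_zero ENNReal.ofNat_ne_top] at h
  simpa using h

theorem volume_level_ne_top {g : Space d → ℂ} (hg : MemLp g 2 volume) {τ : ℝ} (hτ : 0 < τ) :
    volume {y | τ < ‖g y‖} ≠ ∞ := by
  intro h
  have := (volume_level_le hg hτ).trans_lt (lintegral_sq_lt_top hg)
  rw [h, ENNReal.mul_top (by simpa using hτ.ne')] at this
  exact lt_irrefl _ this

/-- By Chebyshev, high level sets have volume at most |B_r|, so only bounded heights t contribute at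
radius r. -/
theorem isProfile_rearrProfile [NeZero d] {g : Space d → ℂ} (hg : MemLp g 2 volume) :
    IsProfile (rearrProfile g) := by
  refine ⟨antitone_rearrProfile g, fun r hr => ?_⟩
  set b : ℝ≥0∞ := volume (Metric.ball (0 : Space d) r)
  have hb0 : b ≠ 0 := (Metric.measure_ball_pos volume 0 hr).ne'
  have hbt : b ≠ ∞ := measure_ball_lt_top.ne
  set E : ℝ≥0∞ := ∫⁻ y, ‖g y‖ₑ ^ 2
  have hE : E ≠ ∞ := (lintegral_sq_lt_top hg).ne
  -- The summand 1 keeps τ positive when E = 0.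
  set τ : ℝ := √(E / b).toReal + 1
  have hτ : 0 < τ := by positivity
  have hEτ : E ≤ ENNReal.ofReal (τ ^ 2) * b := by
    rw [← ENNReal.div_le_iff hb0 hbt, ← ENNReal.ofReal_toReal (ENNReal.div_ne_top hE hb0)]
    refine ENNReal.ofReal_le_ofReal ?_
    have h1 := Real.sq_sqrt (ENNReal.toReal_nonneg (a := E / b))
    have h2 := Real.sqrt_nonneg (E / b).toReal
    simp only [τ]
    nlinarith
  have hvol : volume {y | τ < ‖g y‖} ≤ b := by
    have h := (volume_level_le hg hτ).trans hEτ
    rwa [ENNReal.mul_le_mul_iff_right (by simpa using hτ.ne') ENNReal.ofReal_ne_top] at h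
  have hle : rearrProfile g r ≤ ENNReal.ofReal τ := by
    calc rearrProfile g r ≤ ∫⁻ t in Ioi (0 : ℝ), (Ioc (0 : ℝ) τ).indicator 1 t := by
          refine setLIntegral_mono' measurableSet_Ioi fun t ht => ?_
          refine indicator_one_le_indicator_one fun hrt => ⟨ht, ?_⟩
          by_contra! hlt
          refine absurd (lt_of_lt_of_le hrt ?_) (lt_irrefl r)
          rw [← ballRadius_ball (d := d) hr.le]
          refine ballRadius_mono (le_trans (measure_mono fun y hy => ?_) hvol) hbt
          exact hlt.trans hy
      _ ≤ ∫⁻ t, (Ioc (0 : ℝ) τ).indicator 1 t := setLIntegral_le_lintegral _ _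
      _ = ENNReal.ofReal τ := by
          rw [lintegral_indicator_one measurableSet_Ioc, Real.volume_Ioc, sub_zero]
  exact (hle.trans_lt ENNReal.ofReal_lt_top).ne

theorem symmRearr_congr_ae {g g' : Space d → ℂ} (h : g =ᵐ[volume] g') :
    symmRearr g = symmRearr g' := by
  have hvol : ∀ t : ℝ, volume {y | t < ‖g y‖} = volume {y | t < ‖g' y‖} := fun t => by
    refine measure_congr ?_
    filter_upwards [h] with y hy
    exact congrArg (fun z : ℂ => t < ‖z‖) hy
  funext x
  simp only [symmRearr, setRearr, ballRadius, hvol]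

theorem lt_norm_radial_iff {U : ℝ → ℝ≥0∞} (hU : IsProfile U) {y : Space d} (hy : y ≠ 0) {t : ℝ}
    (ht : 0 < t) : t < ‖radial d U y‖ ↔ ENNReal.ofReal t < U ‖y‖ := by
  rw [← hU.enorm_radial hy, ← ofReal_norm, ENNReal.ofReal_lt_ofReal_iff']
  exact ⟨fun h => ⟨h, ht.trans h⟩, fun h => h.1⟩

theorem ae_ne_zero (d : ℕ) [NeZero d] : ∀ᵐ x : Space d, x ≠ 0 := by
  have : Nonempty (Fin d) := ⟨⟨0, Nat.pos_of_ne_zero (NeZero.ne d)⟩⟩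
  exact Measure.ae_ne volume 0

/-- Radially decreasing functions are their own rearrangements. -/
theorem symmRearr_radial [NeZero d] {U : ℝ → ℝ≥0∞} (hU : IsProfile U)
    (hL : MemLp (radial d U) 2 volume) {x : Space d} (hx : x ≠ 0) (hc : ContinuousAt U ‖x‖) :
    symmRearr (radial d U) x = U ‖x‖ := by
  have hr : 0 < ‖x‖ := norm_pos_iff.mpr hx
  have hone : ∀ r, 0 < r → ∫⁻ t in Ioi (0 : ℝ), {t : ℝ | ENNReal.ofReal t < U r}.indicator 1 t
      = U r := by
    intro r hr
    have hset : Ioi 0 ∩ {t : ℝ | ENNReal.ofReal t < U r} = Ioo 0 (U r).toReal := by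
      ext t
      simp only [mem_inter_iff, mem_Ioi, mem_ofPred_eq, mem_Ioo]
      exact and_congr_right fun ht =>
        ENNReal.ofReal_lt_iff_lt_toReal ht.le (hU.ne_top r hr)
    have hm : MeasurableSet {t : ℝ | ENNReal.ofReal t < U r} :=
      measurableSet_lt ENNReal.measurable_ofReal measurable_const
    rw [lintegral_indicator_one hm, Measure.restrict_apply hm, inter_comm, hset, Real.volume_Ioo,
      sub_zero, ENNReal.ofReal_toReal (hU.ne_top r hr)]
  rw [symmRearr_eq_rearrProfile]
  refine le_antisymm ?_ ?_
  · rw [← hone ‖x‖ hr]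
    refine setLIntegral_mono' measurableSet_Ioi fun t ht => ?_
    refine indicator_one_le_indicator_one fun hrt => ?_
    by_contra hlt
    refine absurd (lt_of_lt_of_le hrt ?_) (lt_irrefl ‖x‖)
    rw [← ballRadius_ball (d := d) (norm_nonneg x)]
    refine ballRadius_mono (measure_mono_ae ?_) measure_ball_lt_top.ne
    filter_upwards [ae_ne_zero d] with y hy hty
    refine mem_ball_zero_iff.mpr (lt_of_not_ge fun hxy => hlt ?_)
    exact ((lt_norm_radial_iff hU hy ht).mp hty).trans_le (hU.antitone hxy)
  -- The rearranged balls are open, so a level set containing B_r almost everywhere is seen at x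
  -- only if r > |x|. This gives U(r) as a lower bound, and continuity lets r decrease to |x|.
  · have hlim : Tendsto U (𝓝[>] ‖x‖) (𝓝 (U ‖x‖)) := hc.mono_left nhdsWithin_le_nhds
    refine le_of_tendsto hlim ?_
    filter_upwards [self_mem_nhdsWithin] with r hxr
    have hr' : 0 < r := hr.trans hxr
    rw [← hone r hr']
    refine setLIntegral_mono' measurableSet_Ioi fun t ht => ?_
    refine indicator_one_le_indicator_one fun htr => ?_
    refine lt_of_lt_of_le (mem_Ioi.mp hxr) ?_
    rw [← ballRadius_ball (d := d) hr'.le]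
    refine ballRadius_mono (measure_mono_ae ?_) (volume_level_ne_top hL ht)
    filter_upwards [ae_ne_zero d] with y hy hyr
    refine (lt_norm_radial_iff hU hy ht).mpr (lt_of_lt_of_le htr (hU.antitone ?_))
    exact (mem_ball_zero_iff.mp hyr).le

/-- A monotone function has countably many discontinuities, and spheres are null. -/
theorem ae_continuousAt_norm [NeZero d] {U : ℝ → ℝ≥0∞} (hU : Antitone U) :
    ∀ᵐ x : Space d, ContinuousAt U ‖x‖ := by
  have : Nonempty (Fin d) := ⟨⟨0, Nat.pos_of_ne_zero (NeZero.ne d)⟩⟩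
  have hcover : {x : Space d | ¬ ContinuousAt U ‖x‖} ⊆
      ⋃ r ∈ {r | ¬ ContinuousAt U r}, Metric.sphere (0 : Space d) r := fun x hx => by
    simpa using hx
  refine measure_mono_null hcover ?_
  rw [measure_biUnion_null_iff hU.countable_not_continuousAt]
  exact fun r _ => Measure.addHaar_sphere volume 0 r

/-! ### Compactness of H^{s,♯} -/

variable [NeZero d]

theorem fourier_fourierRearr_ae (f : L2 d) :
    (𝓕 (fourierRearr f) : L2 d) =ᵐ[volume] radial d (rearrProfile (𝓕 f : L2 d)) := by
  rw [fourierRearr, FourierTransform.fourier_fourierInv_eq]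
  filter_upwards [MemLp.coeFn_toLp (memLp_symmRearr (𝓕 f : L2 d) (Lp.memLp (𝓕 f : L2 d)))]
    with x hx
  rw [hx, symmRearr_eq_rearrProfile, radial]

theorem fourier_ae_of_mem_HsSharp {s : ℝ} {f : L2 d} (hf : f ∈ HsSharp d s) :
    (𝓕 f : L2 d) =ᵐ[volume] radial d (rearrProfile (𝓕 f : L2 d)) := by
  have h := fourier_fourierRearr_ae f
  rwa [← hf.2] at h

/-- A function whose Fourier transform is radially decreasing with finite energy is in `H^{s,♯}`. -/
theorem fourierInv_radial_mem_HsSharp {s : ℝ} (hs : 0 ≤ s) {V : ℝ → ℝ≥0∞} (hV : IsProfile V)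
    (hE : energy s (radial d V) < ∞) (hL : MemLp (radial d V) 2 volume) :
    (𝓕⁻ (hL.toLp : L2 d) : L2 d) ∈ HsSharp d s := by
  have hF : (𝓕 (𝓕⁻ (hL.toLp : L2 d) : L2 d) : L2 d) = hL.toLp :=
    FourierTransform.fourier_fourierInv_eq _
  refine ⟨?_, ?_⟩
  · rw [mem_Hs_iff_energy hs, hF, energy_congr_ae hL.coeFn_toLp]
    exact hE
  · unfold fourierRearr
    congr 1
    refine Lp.ext ?_
    refine hL.coeFn_toLp.trans (EventuallyEq.trans ?_ (MemLp.coeFn_toLp _).symm)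
    rw [hF, symmRearr_congr_ae hL.coeFn_toLp]
    filter_upwards [ae_ne_zero d, ae_continuousAt_norm hV.antitone] with x hx hc
    rw [symmRearr_radial hV hL hx hc, radial]

/-- Sequences of radially decreasing functions of bounded energy have subsequences that converge
almost everywhere to a radially decreasing function of finite energy. -/
theorem exists_subseq_radial {s : ℝ} (hs : 0 ≤ s) (U : ℕ → ℝ → ℝ≥0∞) (hU : ∀ k, IsProfile (U k))
    (M : ℝ≥0) (hM : ∀ k, energy s (radial d (U k)) ≤ M) :
    ∃ φ : ℕ → ℕ, StrictMono φ ∧ ∃ V : ℝ → ℝ≥0∞, IsProfile V ∧ energy s (radial d V) ≤ M ∧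
      ∀ᵐ ξ : Space d, Tendsto (fun m => radial d (U (φ m)) ξ) atTop (𝓝 (radial d V ξ)) := by
  obtain ⟨φ, hφ, V, hVa, hVt, hVb⟩ :=
    exists_subseq_tendsto_of_antitone U fun k => (hU k).antitone
  obtain ⟨C, hC⟩ := exists_radial_le_envelope d hs M
  have : Nonempty (Fin d) := ⟨⟨0, Nat.pos_of_ne_zero (NeZero.ne d)⟩⟩
  have hV : IsProfile V := by
    refine ⟨hVa, fun r hr => ?_⟩
    obtain ⟨ξ, hξ⟩ := exists_norm_eq (Space d) (half_pos hr).le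
    have hξ0 : ξ ≠ 0 := norm_pos_iff.mp (by rw [hξ]; exact half_pos hr)
    -- Helly gives no convergence at discontinuities of V, so finiteness at r comes from the uniform
    -- envelope bound at r/2.
    have h := hVb (r / 2) r (C * ENNReal.ofReal (envelope s ξ)) (half_lt_self hr) fun k => by
      rw [← hξ]
      exact hC _ (hU k) (hM k) ξ hξ0
    exact (h.trans_lt (ENNReal.mul_lt_top ENNReal.coe_lt_top ENNReal.ofReal_lt_top)).ne
  have hlim : ∀ᵐ ξ : Space d,
      Tendsto (fun m => radial d (U (φ m)) ξ) atTop (𝓝 (radial d V ξ)) := by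
    filter_upwards [ae_ne_zero d, ae_continuousAt_norm hVa] with ξ hξ hc
    exact (Complex.continuous_ofReal.tendsto _).comp
      ((ENNReal.tendsto_toReal (hV.ne_top _ (norm_pos_iff.mpr hξ))).comp (hVt _ hc))
  refine ⟨φ, hφ, V, hV, ?_, hlim⟩
  have hFm : ∀ m, Measurable fun ξ : Space d =>
      ENNReal.ofReal (weight s ξ) * ‖radial d (U (φ m)) ξ‖ₑ ^ 2 := fun m =>
    (measurable_weight s).ennreal_ofReal.mul
      ((measurable_radial (hU (φ m)).antitone).enorm.pow_const 2)
  -- Fatou's lemma.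
  calc energy s (radial d V)
      = ∫⁻ ξ, liminf (fun m => ENNReal.ofReal (weight s ξ) *
          ‖radial d (U (φ m)) ξ‖ₑ ^ 2) atTop := by
        refine lintegral_congr_ae ?_
        filter_upwards [hlim] with ξ hξ
        refine (Tendsto.liminf_eq ?_).symm
        exact ENNReal.Tendsto.const_mul ((ENNReal.continuous_pow 2).continuousAt.tendsto.comp
          hξ.enorm) (Or.inr ENNReal.ofReal_ne_top)
    _ ≤ liminf (fun m => energy s (radial d (U (φ m)))) atTop := lintegral_liminf_le hFm
    _ ≤ liminf (fun _ : ℕ => (M : ℝ≥0∞)) atTop :=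
        liminf_le_liminf (Eventually.of_forall fun m => hM (φ m))
    _ = M := liminf_const _

/-- Dominated convergence of radially decreasing functions of bounded energy. -/
theorem tendsto_lintegral_radial_sub {s p : ℝ} (hs : 0 < s) (hp : 2 < p)
    (hpd : p * (d - 2 * s) < 2 * d) {U : ℕ → ℝ → ℝ≥0∞} (hU : ∀ k, IsProfile (U k))
    {V : ℝ → ℝ≥0∞} (hV : IsProfile V) {M : ℝ≥0} (hM : ∀ k, energy s (radial d (U k)) ≤ M)
    (hMV : energy s (radial d V) ≤ M)
    (hlim : ∀ᵐ ξ : Space d, Tendsto (fun m => radial d (U m) ξ) atTop (𝓝 (radial d V ξ))) :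
    Tendsto (fun m => ∫⁻ ξ : Space d, ‖radial d (U m) ξ - radial d V ξ‖ₑ ^ (p / (p - 1)))
      atTop (𝓝 0) := by
  obtain ⟨C, hC⟩ := exists_radial_le_envelope d hs.le M
  have hp1 : 0 < p - 1 := by linarith
  have hq : 0 < p / (p - 1) := div_pos (by linarith) hp1
  have h := tendsto_lintegral_of_dominated_convergence (μ := (volume : Measure (Space d)))
    (F := fun m ξ => ‖radial d (U m) ξ - radial d V ξ‖ₑ ^ (p / (p - 1))) (f := fun _ => 0)
    -- The factor 2 accounts for `U m` and V, each below the same multiple of the envelope.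
    (fun ξ => ((2 * C : ℝ≥0) * ENNReal.ofReal (envelope s ξ)) ^ (p / (p - 1)))
    (fun m => (((measurable_radial (hU m).antitone).sub
      (measurable_radial hV.antitone)).enorm.pow_const _)) ?_ ?_ ?_
  · simpa using h
  · intro m
    filter_upwards [ae_ne_zero d] with ξ hξ
    refine ENNReal.rpow_le_rpow (enorm_sub_le.trans ?_) hq.le
    rw [(hU m).enorm_radial hξ, hV.enorm_radial hξ, ENNReal.coe_mul, ENNReal.coe_ofNat, two_mul,
      add_mul]
    exact add_le_add (hC _ (hU m) (hM m) ξ hξ) (hC _ hV hMV ξ hξ)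
  · simp_rw [ENNReal.mul_rpow_of_nonneg _ _ hq.le]
    rw [lintegral_const_mul' _ _ (ENNReal.rpow_ne_top_of_nonneg hq.le ENNReal.coe_ne_top)]
    exact ENNReal.mul_ne_top (ENNReal.rpow_ne_top_of_nonneg hq.le ENNReal.coe_ne_top)
      (lintegral_envelope_rpow_lt_top hs hp hpd).ne
  · filter_upwards [hlim] with ξ hξ
    have h1 : Tendsto (fun m => ‖radial d (U m) ξ - radial d V ξ‖ₑ) atTop (𝓝 0) := by
      simpa using (hξ.sub_const (radial d V ξ)).enorm
    have h2 := (ENNReal.continuous_rpow_const (y := p / (p - 1))).continuousAt.tendsto.comp h1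
    rwa [ENNReal.zero_rpow_of_pos hq] at h2

/-- Compactness of `H^{s,♯}`, with a subsequence that does not depend on the exponent. -/
theorem exists_subseq_HsSharp {s : ℝ} (hs : 0 < s) (f : ℕ → L2 d) (hf : ∀ k, f k ∈ HsSharp d s)
    (M : ℝ≥0) (hM : ∀ k, sobolevNorm s (f k) ≤ M) :
    ∃ φ : ℕ → ℕ, StrictMono φ ∧ ∃ g ∈ HsSharp d s, ∀ p : ℝ≥0∞, 2 < p → p < pStar s d →
      MemLp g p volume ∧
      Tendsto (fun m => eLpNorm (fun x => f (φ m) x - g x) p volume) atTop (𝓝 0) := by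
  have hae := fun k => fourier_ae_of_mem_HsSharp (hf k)
  set U : ℕ → ℝ → ℝ≥0∞ := fun k => rearrProfile (𝓕 (f k) : L2 d)
  have hU : ∀ k, IsProfile (U k) := fun k => isProfile_rearrProfile (Lp.memLp _)
  have hE : ∀ k, energy s (radial d (U k)) ≤ (M ^ 2 : ℝ≥0) := fun k => by
    have h := hM k
    rw [sobolevNorm_eq, energy_congr_ae (hae k)] at h
    calc energy s (radial d (U k)) = (energy s (radial d (U k)) ^ (1 / 2 : ℝ)) ^ 2 := by
          rw [← ENNReal.rpow_natCast, ← ENNReal.rpow_mul]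
          norm_num
      _ ≤ (M : ℝ≥0∞) ^ 2 := by gcongr
      _ = (M ^ 2 : ℝ≥0) := by push_cast; rfl
  -- The subsequence and the limit are fixed here, before any exponent p appears.
  obtain ⟨φ, hφ, V, hV, hVE, hlim⟩ := exists_subseq_radial hs.le U hU (M ^ 2) hE
  have hVE' : energy s (radial d V) < ∞ := hVE.trans_lt ENNReal.coe_lt_top
  have hL : MemLp (radial d V) 2 volume :=
    memLp_two_of_energy hs.le (measurable_radial hV.antitone) hVE'
  set g : L2 d := 𝓕⁻ (hL.toLp : L2 d)
  have hg : g ∈ HsSharp d s := fourierInv_radial_mem_HsSharp hs.le hV hVE' hL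
  refine ⟨φ, hφ, g, hg, fun p hp hps => ⟨?_, ?_⟩⟩
  · obtain ⟨C, hC⟩ := exists_eLpNorm_le_sobolevNorm hs hp hps
    exact ⟨Lp.aestronglyMeasurable g, (hC g).trans_lt
      (ENNReal.mul_lt_top ENNReal.coe_lt_top (sobolevNorm_lt_top hs.le hg.1))⟩
  · obtain ⟨hpt, hpd⟩ := lt_pStar hps
    have hp2 : 2 < p.toReal := by
      simpa using (ENNReal.toReal_lt_toReal ENNReal.ofNat_ne_top hpt).mpr hp
    obtain ⟨C, hC⟩ := eLpNorm_fourierInv_le (d := d) hp hpt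
    have hpow : 0 < (p.toReal - 1) / p.toReal := div_pos (by linarith) (by linarith)
    have h := tendsto_lintegral_radial_sub hs hp2 hpd (fun m => hU (φ m)) hV
      (fun m => hE (φ m)) hVE hlim
    have h' : Tendsto (fun m => (C : ℝ≥0∞) * (∫⁻ ξ : Space d, ‖radial d (U (φ m)) ξ -
        radial d V ξ‖ₑ ^ (p.toReal / (p.toReal - 1))) ^ ((p.toReal - 1) / p.toReal))
        atTop (𝓝 0) := by
      have h1 := (ENNReal.continuous_rpow_const
        (y := (p.toReal - 1) / p.toReal)).continuousAt.tendsto.comp h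
      simpa [hpow] using ENNReal.Tendsto.const_mul h1 (Or.inr (ENNReal.coe_ne_top (r := C)))
    refine tendsto_of_tendsto_of_tendsto_of_le_of_le tendsto_const_nhds h' (fun _ => zero_le)
      fun m => ?_
    have hsub : 𝓕⁻ ((𝓕 (f (φ m)) : L2 d) - hL.toLp) = f (φ m) - g := by
      have hmap : 𝓕⁻ ((𝓕 (f (φ m)) : L2 d) - hL.toLp) = (𝓕⁻ (𝓕 (f (φ m)) : L2 d) : L2 d) - g :=
        (Lp.fourierTransformₗᵢ (Space d) ℂ).symm.map_sub _ _
      rw [hmap, FourierTransform.fourierInv_fourier_eq]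
    have hb := hC ((𝓕 (f (φ m)) : L2 d) - hL.toLp)
    rw [hsub, eLpNorm_congr_ae (Lp.coeFn_sub _ _)] at hb
    refine hb.trans_eq ?_
    congr 2
    refine lintegral_congr_ae ?_
    filter_upwards [Lp.coeFn_sub (𝓕 (f (φ m)) : L2 d) hL.toLp, hae (φ m), hL.coeFn_toLp]
      with ξ h1 h2 h3
    rw [h1, Pi.sub_apply, h2, h3]

end FourierRearr

end

theorem mainTheorem7 (d : ℕ) [NeZero d] (s : ℝ) (hs : 0 < s) :
    (∀ p : ℝ≥0∞, 2 < p → p < FourierRearr.pStar s d →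
      FourierRearr.CompactlyEmbedded s p (FourierRearr.HsSharp d s)) ∧
    ∀ f : ℕ → FourierRearr.L2 d, (∀ k, f k ∈ FourierRearr.HsSharp d s) →
      (∃ M : ℝ≥0, ∀ k, FourierRearr.sobolevNorm s (f k) ≤ M) →
      ∃ φ : ℕ → ℕ, StrictMono φ ∧ ∃ g ∈ FourierRearr.HsSharp d s,
        ∀ p : ℝ≥0∞, 2 < p → p < FourierRearr.pStar s d →
          MemLp g p volume ∧
          Tendsto (fun m => eLpNorm (fun x => f (φ m) x - g x) p volume) atTop (𝓝 0) := by
  refine ⟨fun p hp hps => ?_, fun f hf ⟨M, hM⟩ => FourierRearr.exists_subseq_HsSharp hs f hf M hM⟩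
  -- Inclusion and the Lipschitz bound hold without symmetry, the latter by applying the embedding
  -- to f - g; only compactness uses f = f^♯.
  obtain ⟨C, hC⟩ := FourierRearr.exists_eLpNorm_le_sobolevNorm (d := d) hs hp hps
  refine ⟨fun f hf => ⟨Lp.aestronglyMeasurable f, (hC f).trans_lt (ENNReal.mul_lt_top
    ENNReal.coe_lt_top (FourierRearr.sobolevNorm_lt_top hs.le hf.1))⟩,
    ⟨C, fun f _ g _ => hC _⟩, fun f hf ⟨M, hM⟩ => ?_⟩
  obtain ⟨φ, hφ, g, -, hg⟩ := FourierRearr.exists_subseq_HsSharp hs f hf M hM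
  exact ⟨φ, hφ, g, hg p hp hps⟩
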